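/- Let $R$ be a commutative ring and let $C$, $D$ be $R$-coalgebras that are flat as $R$-modules. Write $\mathcal M^C$ (resp. ${}^C\mathcal M$) for the category of right (resp. left) $C$-comodules and $C$-colinear maps, and $M\square_C N=\ker(\varrho_M\otimes \mathrm{id}-\mathrm{id}\otimes\varrho_N: M\otimes N\to M\otimes C\otimes N)$ for the cotensor product of $M\in\mathcal M^C$ and $N\in{}^C\mathcal M$; unadorned tensor products are over $R$. For an $R$-module $W$, $W\otimes M$ is a right comodule via $\mathrm{id}\otimes\varrho_M$. A right $C$-comodule $M$ is called - quasi-finite if the functor $-\otimes M: R\text{-Mod}\to\mathcal M^C$ has a left adjoint $h_C(M,-)$; - an injector if $-\otimes M: R\text{-Mod}\to\mathcal M^C$ maps injective objects to injective objects; - faithfully coflat if $M\square_C-:{}^C\mathcal M\to R\text{-Mod}$ is exact and faithful. For a quasi-finite right $C$-comodule $M$, with unit $\eta:M\to h_C(M,M)\otimes M$, the coendomorphism coalgebra is $e_C(M)=h_C(M,M)$, whose comultiplication and counit are the $R$-linear maps that correspond under the adjunction to $(\mathrm{id}\otimes\eta)\eta:M\to e_C(M)\otimes e_C(M)\otimes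 M$ and to the canonical map $M\to R\otimes M$. For left comodules all these notions are defined symmetrically (with $M\otimes -$, $-\square_C M$, and $\eta:M\to M\otimes h_C(M,M)$). Let $F:\mathcal M^C\to\mathcal M^D$ be an $R$-linear equivalence of categories with inverse $G:\mathcal M^D\to\mathcal M^C$. The canonical maps $\lambda_{W,M}:W\otimes F(M)\to F(W\otimes M)$, $w\otimes x\mapsto F(m\mapsto w\otimes m)(x)$, are isomorphisms, and $F(C)$ is a $C$-$D$-bicomodule with left coaction $\lambda_{C,C}^{-1}\circ F(\Delta_C):F(C)\to C\otimes F(C)$; in the same way $G(D)$ is a $D$-$C$-bicomodule. Then: 1. $F(C)$ is quasi-finite, faithfully coflat and an injector, both as a right $D$-comodule and as a left $C$-comodule; 2. $e_D(F(C))\cong C$ and $e_C(F(C))\cong D$ as coalgebras, where $e_D$ is formed from the right $D$-comodule structure and $e_C$ from the left $C$-comodule structure; 3. $G(D)$ is quasi-finite, faithfully coflat and an injector, both as a right $C$-comodule and as a left $D$-comodule; 4. $e_C(G(D))\cong D$ and $e_D(G(D))\cong C$ as coalgebras, where $e_C$ is formed from the right $C$-comodule structure and $e_D$ from the left $D$-comodule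 structure. -/

import Mathlib

open CategoryTheory
open scoped TensorProduct

universe u

/-! ### Coactions on tensor products with a module -/

namespace Coact

variable {R : Type u} [CommRing R] {C M N V W : Type u}
  [AddCommGroup C] [Module R C] [AddCommGroup M] [Module R M] [AddCommGroup N] [Module R N]
  [AddCommGroup V] [Module R V] [AddCommGroup W] [Module R W]

/-- The map `id ⊗ ϱ : W ⊗ M → W ⊗ M ⊗ C` for `ϱ : M → M ⊗ C`. -/
def right (W : Type u) [AddCommGroup W] [Module R W] (ρ : M →ₗ[R] M ⊗[R] C) :
    W ⊗[R] M →ₗ[R] (W ⊗[R] M) ⊗[R] C :=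
  (TensorProduct.assoc R W M C).symm.toLinearMap ∘ₗ ρ.lTensor W

/-- The map `ϱ ⊗ id : M ⊗ W → C ⊗ M ⊗ W` for `ϱ : M → C ⊗ M`. -/
def left (ρ : M →ₗ[R] C ⊗[R] M) (W : Type u) [AddCommGroup W] [Module R W] :
    M ⊗[R] W →ₗ[R] C ⊗[R] (M ⊗[R] W) :=
  (TensorProduct.assoc R C M W).toLinearMap ∘ₗ ρ.rTensor W

@[simp] theorem right_tmul (ρ : M →ₗ[R] M ⊗[R] C) (w : W) (m : M) :
    right W ρ (w ⊗ₜ m) = (TensorProduct.assoc R W M C).symm (w ⊗ₜ ρ m) := rfl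

@[simp] theorem left_tmul (ρ : M →ₗ[R] C ⊗[R] M) (w : W) (m : M) :
    left ρ W (m ⊗ₜ w) = TensorProduct.assoc R C M W (ρ m ⊗ₜ w) := rfl

theorem right_coassoc (Δ : C →ₗ[R] C ⊗[R] C) (ρ : M →ₗ[R] M ⊗[R] C)
    (h : (TensorProduct.assoc R M C C).toLinearMap ∘ₗ ρ.rTensor C ∘ₗ ρ = Δ.lTensor M ∘ₗ ρ) :
    (TensorProduct.assoc R (W ⊗[R] M) C C).toLinearMap ∘ₗ (right W ρ).rTensor C ∘ₗ right W ρ =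
      Δ.lTensor (W ⊗[R] M) ∘ₗ right W ρ := by
  refine TensorProduct.ext' fun w m => ?_
  replace h := LinearMap.congr_fun h m
  simp only [LinearMap.comp_apply, LinearEquiv.coe_coe, right_tmul] at h ⊢
  have h1 : ∀ y : M ⊗[R] C, TensorProduct.assoc R (W ⊗[R] M) C C
      ((right W ρ).rTensor C ((TensorProduct.assoc R W M C).symm (w ⊗ₜ y))) =
      (TensorProduct.assoc R W M (C ⊗[R] C)).symm
        (w ⊗ₜ (TensorProduct.assoc R M C C (ρ.rTensor C y))) := by
    intro y
    induction y with
    | zero => simp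
    | add a b ha hb => simp only [TensorProduct.tmul_add, map_add, ha, hb]
    | tmul a c =>
      simp only [TensorProduct.assoc_symm_tmul, LinearMap.rTensor_tmul, right_tmul]
      generalize ρ a = z
      induction z <;> simp_all [TensorProduct.tmul_add, TensorProduct.add_tmul]
  have h2 : ∀ y : M ⊗[R] C,
      Δ.lTensor (W ⊗[R] M) ((TensorProduct.assoc R W M C).symm (w ⊗ₜ y)) =
      (TensorProduct.assoc R W M (C ⊗[R] C)).symm (w ⊗ₜ (Δ.lTensor M y)) := by
    intro y
    induction y <;> simp_all [TensorProduct.tmul_add]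
  rw [h1, h2, h]

theorem right_counit (ε : C →ₗ[R] R) (ρ : M →ₗ[R] M ⊗[R] C)
    (h : ε.lTensor M ∘ₗ ρ = (TensorProduct.mk R M R).flip 1) :
    ε.lTensor (W ⊗[R] M) ∘ₗ right W ρ = (TensorProduct.mk R (W ⊗[R] M) R).flip 1 := by
  refine TensorProduct.ext' fun w m => ?_
  replace h := LinearMap.congr_fun h m
  simp only [LinearMap.comp_apply, right_tmul, LinearMap.flip_apply,
    TensorProduct.mk_apply] at h ⊢
  have h2 : ∀ y : M ⊗[R] C,
      ε.lTensor (W ⊗[R] M) ((TensorProduct.assoc R W M C).symm (w ⊗ₜ y)) =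
      (TensorProduct.assoc R W M R).symm (w ⊗ₜ (ε.lTensor M y)) := by
    intro y
    induction y <;> simp_all [TensorProduct.tmul_add]
  rw [h2, h, TensorProduct.assoc_symm_tmul]

theorem right_mapLeft (g : V →ₗ[R] W) (ρ : M →ₗ[R] M ⊗[R] C) :
    right W ρ ∘ₗ g.rTensor M = (g.rTensor M).rTensor C ∘ₗ right V ρ := by
  refine TensorProduct.ext' fun v m => ?_
  simp only [LinearMap.comp_apply, LinearMap.rTensor_tmul, right_tmul]
  generalize ρ m = z
  induction z <;> simp_all [TensorProduct.tmul_add]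

theorem right_mapRight (f : M →ₗ[R] N) (ρ : M →ₗ[R] M ⊗[R] C) (σ : N →ₗ[R] N ⊗[R] C)
    (h : σ ∘ₗ f = f.rTensor C ∘ₗ ρ) :
    right W σ ∘ₗ f.lTensor W = (f.lTensor W).rTensor C ∘ₗ right W ρ := by
  refine TensorProduct.ext' fun v m => ?_
  replace h := LinearMap.congr_fun h m
  simp only [LinearMap.comp_apply, LinearMap.lTensor_tmul, right_tmul] at h ⊢
  rw [h]
  generalize ρ m = z
  induction z <;> simp_all [TensorProduct.tmul_add]

theorem right_assoc (ρ : M →ₗ[R] M ⊗[R] C) :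
    right (V ⊗[R] W) ρ ∘ₗ (TensorProduct.assoc R V W M).symm.toLinearMap =
      (TensorProduct.assoc R V W M).symm.toLinearMap.rTensor C ∘ₗ right V (right W ρ) := by
  refine TensorProduct.ext' fun v y => ?_
  induction y with
  | zero => simp
  | add a b ha hb => simp only [TensorProduct.tmul_add, map_add, ha, hb]
  | tmul w m =>
    simp only [LinearMap.comp_apply, LinearEquiv.coe_coe, TensorProduct.assoc_symm_tmul,
      right_tmul]
    generalize ρ m = z
    induction z <;> simp_all [TensorProduct.tmul_add]

theorem right_insert (ρ : M →ₗ[R] M ⊗[R] C) (w : W) :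
    right W ρ ∘ₗ TensorProduct.mk R W M w = (TensorProduct.mk R W M w).rTensor C ∘ₗ ρ := by
  ext m
  simp only [LinearMap.comp_apply, TensorProduct.mk_apply, right_tmul]
  generalize ρ m = z
  induction z <;> simp_all [TensorProduct.tmul_add]

theorem left_coassoc (Δ : C →ₗ[R] C ⊗[R] C) (ρ : M →ₗ[R] C ⊗[R] M)
    (h : (TensorProduct.assoc R C C M).toLinearMap ∘ₗ Δ.rTensor M ∘ₗ ρ = ρ.lTensor C ∘ₗ ρ) :
    (TensorProduct.assoc R C C (M ⊗[R] W)).toLinearMap ∘ₗ Δ.rTensor (M ⊗[R] W) ∘ₗ left ρ W =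
      (left ρ W).lTensor C ∘ₗ left ρ W := by
  refine TensorProduct.ext' fun m w => ?_
  replace h := LinearMap.congr_fun h m
  simp only [LinearMap.comp_apply, LinearEquiv.coe_coe, left_tmul] at h ⊢
  have h1 : ∀ y : C ⊗[R] M,
      (left ρ W).lTensor C (TensorProduct.assoc R C M W (y ⊗ₜ w)) =
      (TensorProduct.assoc R C M W).toLinearMap.lTensor C
        (TensorProduct.assoc R C (C ⊗[R] M) W (ρ.lTensor C y ⊗ₜ w)) := by
    intro y
    induction y <;> simp_all [TensorProduct.add_tmul]
  have h2 : ∀ y : C ⊗[R] M, TensorProduct.assoc R C C (M ⊗[R] W)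
      (Δ.rTensor (M ⊗[R] W) (TensorProduct.assoc R C M W (y ⊗ₜ w))) =
      (TensorProduct.assoc R C M W).toLinearMap.lTensor C
        (TensorProduct.assoc R C (C ⊗[R] M) W
          (TensorProduct.assoc R C C M (Δ.rTensor M y) ⊗ₜ w)) := by
    intro y
    induction y with
    | zero => simp
    | add a b ha hb => simp only [TensorProduct.add_tmul, map_add, ha, hb]
    | tmul a c =>
      simp only [TensorProduct.assoc_tmul, LinearMap.rTensor_tmul]
      generalize Δ a = z
      induction z <;> simp_all [TensorProduct.add_tmul]
  rw [h1, h2, h]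

theorem left_counit (ε : C →ₗ[R] R) (ρ : M →ₗ[R] C ⊗[R] M)
    (h : ε.rTensor M ∘ₗ ρ = TensorProduct.mk R R M 1) :
    ε.rTensor (M ⊗[R] W) ∘ₗ left ρ W = TensorProduct.mk R R (M ⊗[R] W) 1 := by
  refine TensorProduct.ext' fun m w => ?_
  replace h := LinearMap.congr_fun h m
  simp only [LinearMap.comp_apply, left_tmul, TensorProduct.mk_apply] at h ⊢
  have h2 : ∀ y : C ⊗[R] M,
      ε.rTensor (M ⊗[R] W) (TensorProduct.assoc R C M W (y ⊗ₜ w)) =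
      TensorProduct.assoc R R M W (ε.rTensor M y ⊗ₜ w) := by
    intro y
    induction y <;> simp_all [TensorProduct.add_tmul]
  rw [h2, h, TensorProduct.assoc_tmul]

theorem left_mapRight (g : V →ₗ[R] W) (ρ : M →ₗ[R] C ⊗[R] M) :
    left ρ W ∘ₗ g.lTensor M = (g.lTensor M).lTensor C ∘ₗ left ρ V := by
  refine TensorProduct.ext' fun m v => ?_
  simp only [LinearMap.comp_apply, LinearMap.lTensor_tmul, left_tmul]
  generalize ρ m = z
  induction z <;> simp_all [TensorProduct.add_tmul]

theorem left_mapLeft (f : M →ₗ[R] N) (ρ : M →ₗ[R] C ⊗[R] M) (σ : N →ₗ[R] C ⊗[R] N)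
    (h : σ ∘ₗ f = f.lTensor C ∘ₗ ρ) :
    left σ W ∘ₗ f.rTensor W = (f.rTensor W).lTensor C ∘ₗ left ρ W := by
  refine TensorProduct.ext' fun m v => ?_
  replace h := LinearMap.congr_fun h m
  simp only [LinearMap.comp_apply, LinearMap.rTensor_tmul, left_tmul] at h ⊢
  rw [h]
  generalize ρ m = z
  induction z <;> simp_all [TensorProduct.add_tmul]

theorem left_assoc (ρ : M →ₗ[R] C ⊗[R] M) :
    left ρ (V ⊗[R] W) ∘ₗ (TensorProduct.assoc R M V W).toLinearMap =
      (TensorProduct.assoc R M V W).toLinearMap.lTensor C ∘ₗ left (left ρ V) W := by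
  refine TensorProduct.ext_threefold fun m v w => ?_
  simp only [LinearMap.comp_apply, LinearEquiv.coe_coe, TensorProduct.assoc_tmul, left_tmul]
  generalize ρ m = z
  induction z <;> simp_all [TensorProduct.add_tmul]

theorem left_insert (ρ : M →ₗ[R] C ⊗[R] M) (w : W) :
    left ρ W ∘ₗ (TensorProduct.mk R M W).flip w =
      ((TensorProduct.mk R M W).flip w).lTensor C ∘ₗ ρ := by
  ext m
  simp only [LinearMap.comp_apply, LinearMap.flip_apply, TensorProduct.mk_apply, left_tmul]
  generalize ρ m = z
  induction z <;> simp_all [TensorProduct.add_tmul]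

/-! Coassociativity and counitality of the maps induced by a universal map `η : M → V ⊗ M`
(respectively `η : M → M ⊗ V`). -/

theorem coend_right_coassoc (η : M →ₗ[R] V ⊗[R] M) (Δ : V →ₗ[R] V ⊗[R] V)
    (hη : ∀ f g : V →ₗ[R] V ⊗[R] (V ⊗[R] V), f.rTensor M ∘ₗ η = g.rTensor M ∘ₗ η → f = g)
    (hΔ : Δ.rTensor M ∘ₗ η =
      (TensorProduct.assoc R V V M).symm.toLinearMap ∘ₗ η.lTensor V ∘ₗ η) :
    (TensorProduct.assoc R V V V).toLinearMap ∘ₗ Δ.rTensor V ∘ₗ Δ = Δ.lTensor V ∘ₗ Δ := by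
  have hΔ' : ∀ x, Δ.rTensor M (η x) = (TensorProduct.assoc R V V M).symm (η.lTensor V (η x)) :=
    fun x => LinearMap.congr_fun hΔ x
  apply hη
  ext x
  simp only [LinearMap.rTensor_comp, LinearMap.comp_apply, hΔ']
  have h1 : ∀ z : V ⊗[R] M, (TensorProduct.assoc R V V V).toLinearMap.rTensor M
      ((Δ.rTensor V).rTensor M ((TensorProduct.assoc R V V M).symm (η.lTensor V z))) =
      (TensorProduct.assoc R V V V).toLinearMap.rTensor M
        ((TensorProduct.assoc R (V ⊗[R] V) V M).symm (η.lTensor (V ⊗[R] V) (Δ.rTensor M z))) := by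
    intro z
    induction z with
    | zero => simp
    | add a b ha hb => simp only [map_add, ha, hb]
    | tmul v m =>
      simp only [LinearMap.lTensor_tmul, LinearMap.rTensor_tmul]
      generalize η m = y
      induction y <;> simp_all [TensorProduct.tmul_add]
  have h2 : ∀ z : V ⊗[R] M, (Δ.lTensor V).rTensor M
      ((TensorProduct.assoc R V V M).symm (η.lTensor V z)) =
      (TensorProduct.assoc R V (V ⊗[R] V) M).symm
        ((Δ.rTensor M ∘ₗ η).lTensor V z) := by
    intro z
    induction z with
    | zero => simp
    | add a b ha hb => simp only [map_add, ha, hb]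
    | tmul v m =>
      simp only [LinearMap.lTensor_tmul, LinearMap.comp_apply]
      generalize η m = y
      induction y <;> simp_all [TensorProduct.tmul_add]
  rw [h1, h2, hΔ', hΔ]
  generalize η x = z
  induction z with
  | zero => simp
  | add a b ha hb => simp only [map_add, ha, hb]
  | tmul v m =>
    simp only [LinearMap.lTensor_tmul, LinearMap.comp_apply]
    generalize η m = y
    induction y with
    | zero => simp
    | add a b ha hb => simp only [TensorProduct.tmul_add, map_add, ha, hb]
    | tmul a c =>
      simp only [LinearMap.lTensor_tmul, TensorProduct.assoc_symm_tmul, LinearEquiv.coe_coe]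
      generalize η c = y
      induction y <;> simp_all [TensorProduct.tmul_add]

theorem coend_right_rTensor_counit (η : M →ₗ[R] V ⊗[R] M) (Δ : V →ₗ[R] V ⊗[R] V)
    (ε : V →ₗ[R] R)
    (hη : ∀ f g : V →ₗ[R] R ⊗[R] V, f.rTensor M ∘ₗ η = g.rTensor M ∘ₗ η → f = g)
    (hΔ : Δ.rTensor M ∘ₗ η =
      (TensorProduct.assoc R V V M).symm.toLinearMap ∘ₗ η.lTensor V ∘ₗ η)
    (hε : ε.rTensor M ∘ₗ η = TensorProduct.mk R R M 1) :
    ε.rTensor V ∘ₗ Δ = TensorProduct.mk R R V 1 := by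
  have hΔ' : ∀ x, Δ.rTensor M (η x) = (TensorProduct.assoc R V V M).symm (η.lTensor V (η x)) :=
    fun x => LinearMap.congr_fun hΔ x
  have hε' : ∀ x, ε.rTensor M (η x) = 1 ⊗ₜ x := fun x => LinearMap.congr_fun hε x
  apply hη
  ext x
  simp only [LinearMap.rTensor_comp, LinearMap.comp_apply, hΔ']
  have h1 : ∀ z : V ⊗[R] M,
      (ε.rTensor V).rTensor M ((TensorProduct.assoc R V V M).symm (η.lTensor V z)) =
      (TensorProduct.assoc R R V M).symm (η.lTensor R (ε.rTensor M z)) := by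
    intro z
    induction z with
    | zero => simp
    | add a b ha hb => simp only [map_add, ha, hb]
    | tmul v m =>
      simp only [LinearMap.lTensor_tmul, LinearMap.rTensor_tmul]
      generalize η m = y
      induction y <;> simp_all [TensorProduct.tmul_add]
  rw [h1, hε', LinearMap.lTensor_tmul]
  generalize η x = y
  induction y <;> simp_all [TensorProduct.tmul_add]

theorem coend_right_lTensor_counit (η : M →ₗ[R] V ⊗[R] M) (Δ : V →ₗ[R] V ⊗[R] V)
    (ε : V →ₗ[R] R)
    (hη : ∀ f g : V →ₗ[R] V ⊗[R] R, f.rTensor M ∘ₗ η = g.rTensor M ∘ₗ η → f = g)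
    (hΔ : Δ.rTensor M ∘ₗ η =
      (TensorProduct.assoc R V V M).symm.toLinearMap ∘ₗ η.lTensor V ∘ₗ η)
    (hε : ε.rTensor M ∘ₗ η = TensorProduct.mk R R M 1) :
    ε.lTensor V ∘ₗ Δ = (TensorProduct.mk R V R).flip 1 := by
  have hΔ' : ∀ x, Δ.rTensor M (η x) = (TensorProduct.assoc R V V M).symm (η.lTensor V (η x)) :=
    fun x => LinearMap.congr_fun hΔ x
  apply hη
  ext x
  simp only [LinearMap.rTensor_comp, LinearMap.comp_apply, hΔ']
  have h1 : ∀ z : V ⊗[R] M,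
      (ε.lTensor V).rTensor M ((TensorProduct.assoc R V V M).symm (η.lTensor V z)) =
      (TensorProduct.assoc R V R M).symm ((ε.rTensor M ∘ₗ η).lTensor V z) := by
    intro z
    induction z with
    | zero => simp
    | add a b ha hb => simp only [map_add, ha, hb]
    | tmul v m =>
      simp only [LinearMap.lTensor_tmul, LinearMap.comp_apply]
      generalize η m = y
      induction y <;> simp_all [TensorProduct.tmul_add]
  rw [h1, hε]
  generalize η x = y
  induction y <;> simp_all

theorem coend_left_coassoc (η : M →ₗ[R] M ⊗[R] V) (Δ : V →ₗ[R] V ⊗[R] V)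
    (hη : ∀ f g : V →ₗ[R] V ⊗[R] (V ⊗[R] V), f.lTensor M ∘ₗ η = g.lTensor M ∘ₗ η → f = g)
    (hΔ : Δ.lTensor M ∘ₗ η =
      (TensorProduct.assoc R M V V).toLinearMap ∘ₗ η.rTensor V ∘ₗ η) :
    (TensorProduct.assoc R V V V).toLinearMap ∘ₗ Δ.rTensor V ∘ₗ Δ = Δ.lTensor V ∘ₗ Δ := by
  have hΔ' : ∀ x, Δ.lTensor M (η x) = TensorProduct.assoc R M V V (η.rTensor V (η x)) :=
    fun x => LinearMap.congr_fun hΔ x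
  apply hη
  ext x
  simp only [LinearMap.lTensor_comp, LinearMap.comp_apply, hΔ']
  have h1 : ∀ z : M ⊗[R] V, (Δ.lTensor V).lTensor M
      (TensorProduct.assoc R M V V (η.rTensor V z)) =
      TensorProduct.assoc R M V (V ⊗[R] V) (η.rTensor (V ⊗[R] V) (Δ.lTensor M z)) := by
    intro z
    induction z with
    | zero => simp
    | add a b ha hb => simp only [map_add, ha, hb]
    | tmul m v =>
      simp only [LinearMap.lTensor_tmul, LinearMap.rTensor_tmul]
      generalize η m = y
      induction y <;> simp_all [TensorProduct.add_tmul]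
  have h2 : ∀ z : M ⊗[R] V, (TensorProduct.assoc R V V V).toLinearMap.lTensor M
      ((Δ.rTensor V).lTensor M (TensorProduct.assoc R M V V (η.rTensor V z))) =
      (TensorProduct.assoc R V V V).toLinearMap.lTensor M
        (TensorProduct.assoc R M (V ⊗[R] V) V ((Δ.lTensor M ∘ₗ η).rTensor V z)) := by
    intro z
    induction z with
    | zero => simp
    | add a b ha hb => simp only [map_add, ha, hb]
    | tmul m v =>
      simp only [LinearMap.rTensor_tmul, LinearMap.comp_apply]
      generalize η m = y
      induction y <;> simp_all [TensorProduct.add_tmul]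
  rw [h1, h2, hΔ', hΔ]
  generalize η x = z
  induction z with
  | zero => simp
  | add a b ha hb => simp only [map_add, ha, hb]
  | tmul m v =>
    simp only [LinearMap.rTensor_tmul, LinearMap.comp_apply]
    generalize η m = y
    induction y with
    | zero => simp
    | add a b ha hb => simp only [TensorProduct.add_tmul, map_add, ha, hb]
    | tmul a c =>
      simp only [LinearMap.rTensor_tmul, TensorProduct.assoc_tmul, LinearEquiv.coe_coe]
      generalize η a = y
      induction y <;> simp_all [TensorProduct.add_tmul]

theorem coend_left_lTensor_counit (η : M →ₗ[R] M ⊗[R] V) (Δ : V →ₗ[R] V ⊗[R] V)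
    (ε : V →ₗ[R] R)
    (hη : ∀ f g : V →ₗ[R] V ⊗[R] R, f.lTensor M ∘ₗ η = g.lTensor M ∘ₗ η → f = g)
    (hΔ : Δ.lTensor M ∘ₗ η =
      (TensorProduct.assoc R M V V).toLinearMap ∘ₗ η.rTensor V ∘ₗ η)
    (hε : ε.lTensor M ∘ₗ η = (TensorProduct.mk R M R).flip 1) :
    ε.lTensor V ∘ₗ Δ = (TensorProduct.mk R V R).flip 1 := by
  have hΔ' : ∀ x, Δ.lTensor M (η x) = TensorProduct.assoc R M V V (η.rTensor V (η x)) :=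
    fun x => LinearMap.congr_fun hΔ x
  have hε' : ∀ x, ε.lTensor M (η x) = x ⊗ₜ 1 := fun x => LinearMap.congr_fun hε x
  apply hη
  ext x
  simp only [LinearMap.lTensor_comp, LinearMap.comp_apply, hΔ']
  have h1 : ∀ z : M ⊗[R] V,
      (ε.lTensor V).lTensor M (TensorProduct.assoc R M V V (η.rTensor V z)) =
      TensorProduct.assoc R M V R (η.rTensor R (ε.lTensor M z)) := by
    intro z
    induction z with
    | zero => simp
    | add a b ha hb => simp only [map_add, ha, hb]
    | tmul m v =>
      simp only [LinearMap.lTensor_tmul, LinearMap.rTensor_tmul]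
      generalize η m = y
      induction y <;> simp_all [TensorProduct.add_tmul]
  rw [h1, hε', LinearMap.rTensor_tmul]
  generalize η x = y
  induction y <;> simp_all [TensorProduct.add_tmul]

theorem coend_left_rTensor_counit (η : M →ₗ[R] M ⊗[R] V) (Δ : V →ₗ[R] V ⊗[R] V)
    (ε : V →ₗ[R] R)
    (hη : ∀ f g : V →ₗ[R] R ⊗[R] V, f.lTensor M ∘ₗ η = g.lTensor M ∘ₗ η → f = g)
    (hΔ : Δ.lTensor M ∘ₗ η =
      (TensorProduct.assoc R M V V).toLinearMap ∘ₗ η.rTensor V ∘ₗ η)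
    (hε : ε.lTensor M ∘ₗ η = (TensorProduct.mk R M R).flip 1) :
    ε.rTensor V ∘ₗ Δ = TensorProduct.mk R R V 1 := by
  have hΔ' : ∀ x, Δ.lTensor M (η x) = TensorProduct.assoc R M V V (η.rTensor V (η x)) :=
    fun x => LinearMap.congr_fun hΔ x
  apply hη
  ext x
  simp only [LinearMap.lTensor_comp, LinearMap.comp_apply, hΔ']
  have h1 : ∀ z : M ⊗[R] V,
      (ε.rTensor V).lTensor M (TensorProduct.assoc R M V V (η.rTensor V z)) =
      TensorProduct.assoc R M R V ((ε.lTensor M ∘ₗ η).rTensor V z) := by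
    intro z
    induction z with
    | zero => simp
    | add a b ha hb => simp only [map_add, ha, hb]
    | tmul m v =>
      simp only [LinearMap.rTensor_tmul, LinearMap.comp_apply]
      generalize η m = y
      induction y <;> simp_all [TensorProduct.add_tmul]
  rw [h1, hε]
  generalize η x = y
  induction y <;> simp_all

end Coact

/-! ### Right comodules -/

/-- A right comodule over an `R`-coalgebra `C`. -/
structure RightComod (R : Type u) [CommRing R] (C : Type u) [AddCommGroup C] [Module R C]
    [Coalgebra R C] where
  carrier : Type u
  [addCommGroup : AddCommGroup carrier]
  [module : Module R carrier]
  coact : carrier →ₗ[R] carrier ⊗[R] C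
  coassoc : (TensorProduct.assoc R carrier C C).toLinearMap ∘ₗ coact.rTensor C ∘ₗ coact =
    (Coalgebra.comul (R := R) (A := C)).lTensor carrier ∘ₗ coact
  counit_coact : (Coalgebra.counit (R := R) (A := C)).lTensor carrier ∘ₗ coact =
    (TensorProduct.mk R carrier R).flip 1

attribute [instance] RightComod.addCommGroup RightComod.module

namespace RightComod

section Basic

variable {R : Type u} [CommRing R] {C : Type u} [AddCommGroup C] [Module R C] [Coalgebra R C]

/-- `C`-colinear maps. -/
@[ext]
structure Hom (M N : RightComod R C) where
  lin : M.carrier →ₗ[R] N.carrier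
  colinear : N.coact ∘ₗ lin = lin.rTensor C ∘ₗ M.coact

/-- The category of right `C`-comodules and `C`-colinear maps. -/
instance category : Category (RightComod R C) where
  Hom M N := Hom M N
  id M := ⟨LinearMap.id, by simp⟩
  comp {L M N} f g := ⟨g.lin ∘ₗ f.lin, by
    rw [← LinearMap.comp_assoc, g.colinear, LinearMap.comp_assoc, f.colinear,
      LinearMap.rTensor_comp, LinearMap.comp_assoc]⟩

@[ext]
theorem hom_ext {M N : RightComod R C} {f g : M ⟶ N} (h : f.lin = g.lin) : f = g :=
  Hom.ext h

@[simp] theorem id_lin (M : RightComod R C) : Hom.lin (𝟙 M) = LinearMap.id := rfl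

@[simp] theorem comp_lin {L M N : RightComod R C} (f : L ⟶ M) (g : M ⟶ N) :
    (f ≫ g).lin = g.lin ∘ₗ f.lin := rfl

/-- Colinear maps are added and scaled as linear maps. -/
instance homZero (M N : RightComod R C) : Zero (M ⟶ N) := ⟨⟨0, by simp⟩⟩

instance homAdd (M N : RightComod R C) : Add (M ⟶ N) := ⟨fun f g => ⟨f.lin + g.lin, by
  rw [LinearMap.comp_add, f.colinear, g.colinear, LinearMap.rTensor_add, LinearMap.add_comp]⟩⟩

instance homNeg (M N : RightComod R C) : Neg (M ⟶ N) := ⟨fun f => ⟨-f.lin, by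
  rw [LinearMap.comp_neg, f.colinear, LinearMap.rTensor_neg, LinearMap.neg_comp]⟩⟩

instance homAddCommGroup (M N : RightComod R C) : AddCommGroup (M ⟶ N) where
  add_assoc f g h := hom_ext (add_assoc f.lin g.lin h.lin)
  zero_add f := hom_ext (zero_add f.lin)
  add_zero f := hom_ext (add_zero f.lin)
  add_comm f g := hom_ext (add_comm f.lin g.lin)
  neg_add_cancel f := hom_ext (neg_add_cancel f.lin)
  nsmul := nsmulRec
  zsmul := zsmulRec

@[simp] theorem add_lin {M N : RightComod R C} (f g : M ⟶ N) : (f + g).lin = f.lin + g.lin := rfl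

instance homModule (M N : RightComod R C) : Module R (M ⟶ N) where
  smul r f := ⟨r • f.lin, by
    rw [LinearMap.comp_smul, f.colinear, LinearMap.rTensor_smul, LinearMap.smul_comp]⟩
  one_smul f := hom_ext (one_smul R f.lin)
  mul_smul r s f := hom_ext (mul_smul r s f.lin)
  smul_zero r := hom_ext (smul_zero r)
  smul_add r f g := hom_ext (smul_add r f.lin g.lin)
  add_smul r s f := hom_ext (add_smul r s f.lin)
  zero_smul f := hom_ext (zero_smul R f.lin)

@[simp] theorem smul_lin {M N : RightComod R C} (r : R) (f : M ⟶ N) :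
    (r • f).lin = r • f.lin := rfl

instance : Preadditive (RightComod R C) where
  add_comp _ _ _ f g h := by ext x; simp
  comp_add _ _ _ f g h := by ext x; simp

instance : Linear R (RightComod R C) where
  smul_comp _ _ _ r f g := by ext x; simp
  comp_smul _ _ _ f r g := by ext x; simp

variable {V W : Type u} [AddCommGroup V] [Module R V] [AddCommGroup W] [Module R W]

/-- `C` as a right comodule over itself. -/
def regular (R : Type u) [CommRing R] (C : Type u) [AddCommGroup C] [Module R C]
    [Coalgebra R C] : RightComod R C where
  carrier := C
  coact := Coalgebra.comul
  coassoc := Coalgebra.coassoc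
  counit_coact := Coalgebra.lTensor_counit_comp_comul

/-- `W ⊗ M` with the coaction `id ⊗ ϱ_M`, for an `R`-module `W`. -/
abbrev tensor (W : Type u) [AddCommGroup W] [Module R W] (M : RightComod R C) :
    RightComod R C where
  carrier := W ⊗[R] M.carrier
  coact := Coact.right W M.coact
  coassoc := Coact.right_coassoc _ _ M.coassoc
  counit_coact := Coact.right_counit _ _ M.counit_coact

/-- `g ⊗ id : V ⊗ M ⟶ W ⊗ M` for an `R`-linear map `g : V → W`. -/
def tensorMapLeft
    (g : V →ₗ[R] W) (M : RightComod R C) : tensor V M ⟶ tensor W M where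
  lin := g.rTensor M.carrier
  colinear := Coact.right_mapLeft g M.coact

/-- `id ⊗ f : W ⊗ M ⟶ W ⊗ N` for a colinear map `f : M ⟶ N`. -/
def tensorMapRight (W : Type u) [AddCommGroup W] [Module R W] {M N : RightComod R C}
    (f : M ⟶ N) : tensor W M ⟶ tensor W N where
  lin := f.lin.lTensor W
  colinear := Coact.right_mapRight f.lin M.coact N.coact f.colinear

/-- The colinear isomorphism `V ⊗ (W ⊗ M) ⟶ (V ⊗ W) ⊗ M`. -/
def tensorAssocInv (V W : Type u) [AddCommGroup V] [Module R V] [AddCommGroup W] [Module R W]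
    (M : RightComod R C) : tensor V (tensor W M) ⟶ tensor (V ⊗[R] W) M where
  lin := (TensorProduct.assoc R V W M.carrier).symm.toLinearMap
  colinear := Coact.right_assoc M.coact

/-- For `w ∈ W` the colinear map `M ⟶ W ⊗ M`, `m ↦ w ⊗ m`. -/
def insert (w : W) (M : RightComod R C) :
    M ⟶ tensor W M where
  lin := TensorProduct.mk R W M.carrier w
  colinear := Coact.right_insert M.coact w

/-- The functor `- ⊗ M` from `R`-modules to right `C`-comodules. -/
def tensorFunctor (M : RightComod R C) : ModuleCat.{u} R ⥤ RightComod R C where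
  obj W := tensor W M
  map g := tensorMapLeft g.hom M
  map_id _ := hom_ext (LinearMap.rTensor_id _ _)
  map_comp f g := hom_ext (LinearMap.rTensor_comp _ g.hom f.hom)

/-- `M` is quasi-finite: the functor `- ⊗ M` has a left adjoint (the cohom functor). -/
abbrev QuasiFinite (M : RightComod R C) : Prop := M.tensorFunctor.IsRightAdjoint

/-- `M` is an injector: the functor `- ⊗ M` respects injective objects. -/
def Injector (M : RightComod R C) : Prop :=
  ∀ W : ModuleCat.{u} R, Injective W → Injective (M.tensorFunctor.obj W)

/-- The cohom functor of a quasi-finite comodule `X`. -/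
noncomputable def cohom (X : RightComod R C) [QuasiFinite X] : RightComod R C ⥤ ModuleCat.{u} R :=
  X.tensorFunctor.leftAdjoint

/-- The adjunction between the cohom functor and `- ⊗ X`. -/
noncomputable def cohomAdj (X : RightComod R C) [QuasiFinite X] : X.cohom ⊣ X.tensorFunctor :=
  Adjunction.ofIsRightAdjoint X.tensorFunctor

/-- The `R`-linear map `h(X, M) → W` corresponding to a colinear map `M ⟶ W ⊗ X`. -/
noncomputable def cohomDesc (X : RightComod R C) [QuasiFinite X] {M : RightComod R C} (f : M ⟶ tensor W X) : X.cohom.obj M →ₗ[R] W :=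
  ((X.cohomAdj.homEquiv M (ModuleCat.of R W)).symm f).hom

/-- The underlying module `h(X, X)` of the coendomorphism coalgebra of `X`. -/
def Coend (X : RightComod R C) [QuasiFinite X] : Type u := X.cohom.obj X

noncomputable instance (X : RightComod R C) [QuasiFinite X] : AddCommGroup X.Coend :=
  inferInstanceAs (AddCommGroup (X.cohom.obj X))

noncomputable instance (X : RightComod R C) [QuasiFinite X] : Module R X.Coend :=
  inferInstanceAs (Module R (X.cohom.obj X))

/-- The unit `X ⟶ h(X, X) ⊗ X` of the cohom adjunction. -/
noncomputable def coendUnit (X : RightComod R C) [QuasiFinite X] : X ⟶ tensor X.Coend X :=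
  X.cohomAdj.unit.app X

/-- The comultiplication of `h(X, X)` corresponds to `(id ⊗ η) η : X ⟶ h(X, X) ⊗ h(X, X) ⊗ X`. -/
noncomputable def coendComul (X : RightComod R C) [QuasiFinite X] :
    X.Coend →ₗ[R] X.Coend ⊗[R] X.Coend :=
  X.cohomDesc (X.coendUnit ≫ tensorMapRight X.Coend X.coendUnit ≫
    tensorAssocInv X.Coend X.Coend X)

/-- The counit of `h(X, X)` corresponds to the canonical map `X ⟶ R ⊗ X`. -/
noncomputable def coendCounit (X : RightComod R C) [QuasiFinite X] : X.Coend →ₗ[R] R :=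
  X.cohomDesc (insert (1 : R) X)

theorem cohomDesc_unit (X : RightComod R C) [QuasiFinite X] (f : X ⟶ tensor W X) :
    LinearMap.rTensor X.carrier (show X.Coend →ₗ[R] W from X.cohomDesc f) ∘ₗ X.coendUnit.lin =
      f.lin := by
  have h : X.cohomAdj.unit.app X ≫ X.tensorFunctor.map
      ((X.cohomAdj.homEquiv X (ModuleCat.of R W)).symm f) = f :=
    (X.cohomAdj.homEquiv_unit X (ModuleCat.of R W) _).symm.trans (Equiv.apply_symm_apply _ _)
  exact congrArg Hom.lin h

theorem coend_hom_ext (X : RightComod R C) [QuasiFinite X] (f g : X.Coend →ₗ[R] W)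
    (h : f.rTensor X.carrier ∘ₗ X.coendUnit.lin = g.rTensor X.carrier ∘ₗ X.coendUnit.lin) :
    f = g := by
  have h' : (X.cohomAdj.homEquiv X (ModuleCat.of R W)) (ModuleCat.ofHom f) =
      (X.cohomAdj.homEquiv X (ModuleCat.of R W)) (ModuleCat.ofHom g) := by
    rw [Adjunction.homEquiv_unit, Adjunction.homEquiv_unit]
    exact hom_ext h
  exact congrArg ModuleCat.Hom.hom (Equiv.injective _ h')

/-- The coendomorphism coalgebra of a quasi-finite right comodule. -/
noncomputable instance coendCoalgebra (X : RightComod R C) [QuasiFinite X] :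
    Coalgebra R X.Coend where
  comul := X.coendComul
  counit := X.coendCounit
  coassoc := Coact.coend_right_coassoc X.coendUnit.lin X.coendComul
    X.coend_hom_ext (X.cohomDesc_unit _)
  rTensor_counit_comp_comul := Coact.coend_right_rTensor_counit X.coendUnit.lin X.coendComul
    X.coendCounit X.coend_hom_ext (X.cohomDesc_unit _) (X.cohomDesc_unit _)
  lTensor_counit_comp_comul := Coact.coend_right_lTensor_counit X.coendUnit.lin X.coendComul
    X.coendCounit X.coend_hom_ext (X.cohomDesc_unit _) (X.cohomDesc_unit _)

end Basic
end RightComod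

/-! ### Left comodules -/

/-- A left comodule over an `R`-coalgebra `C`. -/
structure LeftComod (R : Type u) [CommRing R] (C : Type u) [AddCommGroup C] [Module R C]
    [Coalgebra R C] where
  carrier : Type u
  [addCommGroup : AddCommGroup carrier]
  [module : Module R carrier]
  coact : carrier →ₗ[R] C ⊗[R] carrier
  coassoc : (TensorProduct.assoc R C C carrier).toLinearMap ∘ₗ
    (Coalgebra.comul (R := R) (A := C)).rTensor carrier ∘ₗ coact = coact.lTensor C ∘ₗ coact
  counit_coact : (Coalgebra.counit (R := R) (A := C)).rTensor carrier ∘ₗ coact =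
    TensorProduct.mk R R carrier 1

attribute [instance] LeftComod.addCommGroup LeftComod.module

namespace LeftComod

section Basic

variable {R : Type u} [CommRing R] {C : Type u} [AddCommGroup C] [Module R C] [Coalgebra R C]
  {V W : Type u} [AddCommGroup V] [Module R V] [AddCommGroup W] [Module R W]

/-- `C`-colinear maps. -/
@[ext]
structure Hom (M N : LeftComod R C) where
  lin : M.carrier →ₗ[R] N.carrier
  colinear : N.coact ∘ₗ lin = lin.lTensor C ∘ₗ M.coact

/-- The category of left `C`-comodules and `C`-colinear maps. -/
instance category : Category (LeftComod R C) where
  Hom M N := Hom M N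
  id M := ⟨LinearMap.id, by simp⟩
  comp {L M N} f g := ⟨g.lin ∘ₗ f.lin, by
    rw [← LinearMap.comp_assoc, g.colinear, LinearMap.comp_assoc, f.colinear,
      LinearMap.lTensor_comp, LinearMap.comp_assoc]⟩

@[ext]
theorem hom_ext {M N : LeftComod R C} {f g : M ⟶ N} (h : f.lin = g.lin) : f = g :=
  Hom.ext h

@[simp] theorem id_lin (M : LeftComod R C) : Hom.lin (𝟙 M) = LinearMap.id := rfl

@[simp] theorem comp_lin {L M N : LeftComod R C} (f : L ⟶ M) (g : M ⟶ N) :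
    (f ≫ g).lin = g.lin ∘ₗ f.lin := rfl

/-- `M ⊗ W` with the coaction `ϱ_M ⊗ id`, for an `R`-module `W`. -/
abbrev tensor (M : LeftComod R C) (W : Type u) [AddCommGroup W] [Module R W] :
    LeftComod R C where
  carrier := M.carrier ⊗[R] W
  coact := Coact.left M.coact W
  coassoc := Coact.left_coassoc _ _ M.coassoc
  counit_coact := Coact.left_counit _ _ M.counit_coact

/-- `id ⊗ g : M ⊗ V ⟶ M ⊗ W` for an `R`-linear map `g : V → W`. -/
def tensorMapRight
    (M : LeftComod R C) (g : V →ₗ[R] W) : tensor M V ⟶ tensor M W where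
  lin := g.lTensor M.carrier
  colinear := Coact.left_mapRight g M.coact

/-- `f ⊗ id : M ⊗ W ⟶ N ⊗ W` for a colinear map `f : M ⟶ N`. -/
def tensorMapLeft {M N : LeftComod R C} (f : M ⟶ N) (W : Type u) [AddCommGroup W] [Module R W] :
    tensor M W ⟶ tensor N W where
  lin := f.lin.rTensor W
  colinear := Coact.left_mapLeft f.lin M.coact N.coact f.colinear

/-- The colinear isomorphism `(M ⊗ V) ⊗ W ⟶ M ⊗ (V ⊗ W)`. -/
def tensorAssoc (M : LeftComod R C) (V W : Type u) [AddCommGroup V] [Module R V]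
    [AddCommGroup W] [Module R W] : tensor (tensor M V) W ⟶ tensor M (V ⊗[R] W) where
  lin := (TensorProduct.assoc R M.carrier V W).toLinearMap
  colinear := Coact.left_assoc M.coact

/-- For `w ∈ W` the colinear map `M ⟶ M ⊗ W`, `m ↦ m ⊗ w`. -/
def insert (M : LeftComod R C) (w : W) :
    M ⟶ tensor M W where
  lin := (TensorProduct.mk R M.carrier W).flip w
  colinear := Coact.left_insert M.coact w

/-- The functor `M ⊗ -` from `R`-modules to left `C`-comodules. -/
def tensorFunctor (M : LeftComod R C) : ModuleCat.{u} R ⥤ LeftComod R C where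
  obj W := tensor M W
  map g := tensorMapRight M g.hom
  map_id _ := hom_ext (LinearMap.lTensor_id _ _)
  map_comp f g := hom_ext (LinearMap.lTensor_comp _ g.hom f.hom)

/-- `M` is quasi-finite: the functor `M ⊗ -` has a left adjoint (the cohom functor). -/
abbrev QuasiFinite (M : LeftComod R C) : Prop := M.tensorFunctor.IsRightAdjoint

/-- `M` is an injector: the functor `M ⊗ -` respects injective objects. -/
def Injector (M : LeftComod R C) : Prop :=
  ∀ W : ModuleCat.{u} R, Injective W → Injective (M.tensorFunctor.obj W)

/-- The cohom functor of a quasi-finite comodule `X`. -/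
noncomputable def cohom (X : LeftComod R C) [QuasiFinite X] : LeftComod R C ⥤ ModuleCat.{u} R :=
  X.tensorFunctor.leftAdjoint

/-- The adjunction between the cohom functor and `X ⊗ -`. -/
noncomputable def cohomAdj (X : LeftComod R C) [QuasiFinite X] : X.cohom ⊣ X.tensorFunctor :=
  Adjunction.ofIsRightAdjoint X.tensorFunctor

/-- The `R`-linear map `h(X, M) → W` corresponding to a colinear map `M ⟶ X ⊗ W`. -/
noncomputable def cohomDesc (X : LeftComod R C) [QuasiFinite X] {M : LeftComod R C} (f : M ⟶ tensor X W) : X.cohom.obj M →ₗ[R] W :=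
  ((X.cohomAdj.homEquiv M (ModuleCat.of R W)).symm f).hom

/-- The underlying module `h(X, X)` of the coendomorphism coalgebra of `X`. -/
def Coend (X : LeftComod R C) [QuasiFinite X] : Type u := X.cohom.obj X

noncomputable instance (X : LeftComod R C) [QuasiFinite X] : AddCommGroup X.Coend :=
  inferInstanceAs (AddCommGroup (X.cohom.obj X))

noncomputable instance (X : LeftComod R C) [QuasiFinite X] : Module R X.Coend :=
  inferInstanceAs (Module R (X.cohom.obj X))

/-- The unit `X ⟶ X ⊗ h(X, X)` of the cohom adjunction. -/
noncomputable def coendUnit (X : LeftComod R C) [QuasiFinite X] : X ⟶ tensor X X.Coend :=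
  X.cohomAdj.unit.app X

/-- The comultiplication of `h(X, X)` corresponds to `(η ⊗ id) η : X ⟶ X ⊗ h(X, X) ⊗ h(X, X)`. -/
noncomputable def coendComul (X : LeftComod R C) [QuasiFinite X] :
    X.Coend →ₗ[R] X.Coend ⊗[R] X.Coend :=
  X.cohomDesc (X.coendUnit ≫ tensorMapLeft X.coendUnit X.Coend ≫
    tensorAssoc X X.Coend X.Coend)

/-- The counit of `h(X, X)` corresponds to the canonical map `X ⟶ X ⊗ R`. -/
noncomputable def coendCounit (X : LeftComod R C) [QuasiFinite X] : X.Coend →ₗ[R] R :=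
  X.cohomDesc (insert X (1 : R))

theorem cohomDesc_unit (X : LeftComod R C) [QuasiFinite X] (f : X ⟶ tensor X W) :
    LinearMap.lTensor X.carrier (show X.Coend →ₗ[R] W from X.cohomDesc f) ∘ₗ X.coendUnit.lin =
      f.lin := by
  have h : X.cohomAdj.unit.app X ≫ X.tensorFunctor.map
      ((X.cohomAdj.homEquiv X (ModuleCat.of R W)).symm f) = f :=
    (X.cohomAdj.homEquiv_unit X (ModuleCat.of R W) _).symm.trans (Equiv.apply_symm_apply _ _)
  exact congrArg Hom.lin h

theorem coend_hom_ext (X : LeftComod R C) [QuasiFinite X] (f g : X.Coend →ₗ[R] W)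
    (h : f.lTensor X.carrier ∘ₗ X.coendUnit.lin = g.lTensor X.carrier ∘ₗ X.coendUnit.lin) :
    f = g := by
  have h' : (X.cohomAdj.homEquiv X (ModuleCat.of R W)) (ModuleCat.ofHom f) =
      (X.cohomAdj.homEquiv X (ModuleCat.of R W)) (ModuleCat.ofHom g) := by
    rw [Adjunction.homEquiv_unit, Adjunction.homEquiv_unit]
    exact hom_ext h
  exact congrArg ModuleCat.Hom.hom (Equiv.injective _ h')

/-- The coendomorphism coalgebra of a quasi-finite left comodule. -/
noncomputable instance coendCoalgebra (X : LeftComod R C) [QuasiFinite X] :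
    Coalgebra R X.Coend where
  comul := X.coendComul
  counit := X.coendCounit
  coassoc := Coact.coend_left_coassoc X.coendUnit.lin X.coendComul
    X.coend_hom_ext (X.cohomDesc_unit _)
  rTensor_counit_comp_comul := Coact.coend_left_rTensor_counit X.coendUnit.lin X.coendComul
    X.coendCounit X.coend_hom_ext (X.cohomDesc_unit _) (X.cohomDesc_unit _)
  lTensor_counit_comp_comul := Coact.coend_left_lTensor_counit X.coendUnit.lin X.coendComul
    X.coendCounit X.coend_hom_ext (X.cohomDesc_unit _) (X.cohomDesc_unit _)

end Basic
end LeftComod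

/-! ### The cotensor product and coflatness -/

section Cotensor

variable {R : Type u} [CommRing R] {C : Type u} [AddCommGroup C] [Module R C] [Coalgebra R C]

/-- The map `ϱ_M ⊗ id - id ⊗ ϱ_N : M ⊗ N → M ⊗ C ⊗ N`. -/
def cotensorDiff (M : RightComod R C) (N : LeftComod R C) :
    M.carrier ⊗[R] N.carrier →ₗ[R] M.carrier ⊗[R] (C ⊗[R] N.carrier) :=
  (TensorProduct.assoc R M.carrier C N.carrier).toLinearMap ∘ₗ M.coact.rTensor N.carrier -
    N.coact.lTensor M.carrier

/-- The cotensor product of a right and a left comodule, as a submodule of `M ⊗ N`. -/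
def cotensor (M : RightComod R C) (N : LeftComod R C) : Submodule R (M.carrier ⊗[R] N.carrier) :=
  LinearMap.ker (cotensorDiff M N)

theorem cotensorDiff_map {M M' : RightComod R C} {N N' : LeftComod R C} (f : M ⟶ M')
    (g : N ⟶ N') (z : M.carrier ⊗[R] N.carrier) :
    cotensorDiff M' N' (TensorProduct.map f.lin g.lin z) =
      TensorProduct.map f.lin (g.lin.lTensor C) (cotensorDiff M N z) := by
  induction z with
  | zero => simp
  | add a b ha hb => simp only [map_add, ha, hb]
  | tmul m n =>
    have hf := LinearMap.congr_fun f.colinear m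
    have hg := LinearMap.congr_fun g.colinear n
    simp only [LinearMap.comp_apply] at hf hg
    simp only [cotensorDiff, LinearMap.sub_apply, LinearMap.comp_apply, LinearEquiv.coe_coe,
      TensorProduct.map_tmul, LinearMap.rTensor_tmul, LinearMap.lTensor_tmul, map_sub, hf, hg]
    congr 1
    generalize M.coact m = y
    induction y <;> simp_all [TensorProduct.add_tmul]

/-- The map `f ⊗ g` restricted to cotensor products, for colinear maps `f` and `g`. -/
def cotensorMap {M M' : RightComod R C} {N N' : LeftComod R C} (f : M ⟶ M') (g : N ⟶ N') :
    cotensor M N →ₗ[R] cotensor M' N' :=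
  (TensorProduct.map f.lin g.lin).restrict fun z hz => by
    rw [cotensor, LinearMap.mem_ker] at hz ⊢
    rw [cotensorDiff_map, hz, map_zero]

theorem cotensorMap_id (M : RightComod R C) (N : LeftComod R C) :
    cotensorMap (𝟙 M) (𝟙 N) = LinearMap.id :=
  LinearMap.ext fun z => Subtype.ext (LinearMap.congr_fun TensorProduct.map_id z.1)

theorem cotensorMap_comp {M M' M'' : RightComod R C} {N N' N'' : LeftComod R C} (f : M ⟶ M')
    (f' : M' ⟶ M'') (g : N ⟶ N') (g' : N' ⟶ N'') :
    cotensorMap (f ≫ f') (g ≫ g') = cotensorMap f' g' ∘ₗ cotensorMap f g :=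
  LinearMap.ext fun z => Subtype.ext (LinearMap.congr_fun
    (TensorProduct.map_comp f'.lin g'.lin f.lin g.lin) z.1)

/-- The functor `M □ -` from left `C`-comodules to `R`-modules. -/
def RightComod.cotensorFunctor (M : RightComod R C) : LeftComod R C ⥤ ModuleCat.{u} R where
  obj N := ModuleCat.of R (cotensor M N)
  map g := ModuleCat.ofHom (cotensorMap (𝟙 M) g)
  map_id N := ModuleCat.hom_ext (cotensorMap_id M N)
  map_comp f g := ModuleCat.hom_ext (cotensorMap_comp (𝟙 M) (𝟙 M) f g)

/-- The functor `- □ N` from right `C`-comodules to `R`-modules. -/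
def LeftComod.cotensorFunctor (N : LeftComod R C) : RightComod R C ⥤ ModuleCat.{u} R where
  obj M := ModuleCat.of R (cotensor M N)
  map f := ModuleCat.ofHom (cotensorMap f (𝟙 N))
  map_id M := ModuleCat.hom_ext (cotensorMap_id M N)
  map_comp f g := ModuleCat.hom_ext (cotensorMap_comp f g (𝟙 N) (𝟙 N))

/-- `M` is coflat: the functor `M □ -` is exact. (For a coalgebra that is flat as an `R`-module,
exactness of a sequence of comodules means exactness of the underlying sequence of modules.) -/
def RightComod.Coflat (M : RightComod R C) : Prop :=
  ∀ ⦃N₁ N₂ N₃ : LeftComod R C⦄ (f : N₁ ⟶ N₂) (g : N₂ ⟶ N₃), Function.Exact f.lin g.lin →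
    Function.Exact (M.cotensorFunctor.map f) (M.cotensorFunctor.map g)

/-- `M` is faithfully coflat: the functor `M □ -` is exact and faithful. -/
def RightComod.FaithfullyCoflat (M : RightComod R C) : Prop :=
  M.Coflat ∧ M.cotensorFunctor.Faithful

/-- `N` is coflat: the functor `- □ N` is exact. (For a coalgebra that is flat as an `R`-module,
exactness of a sequence of comodules means exactness of the underlying sequence of modules.) -/
def LeftComod.Coflat (N : LeftComod R C) : Prop :=
  ∀ ⦃M₁ M₂ M₃ : RightComod R C⦄ (f : M₁ ⟶ M₂) (g : M₂ ⟶ M₃), Function.Exact f.lin g.lin →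
    Function.Exact (N.cotensorFunctor.map f) (N.cotensorFunctor.map g)

/-- `N` is faithfully coflat: the functor `- □ N` is exact and faithful. -/
def LeftComod.FaithfullyCoflat (N : LeftComod R C) : Prop :=
  N.Coflat ∧ N.cotensorFunctor.Faithful

end Cotensor

/-! ### Bicomodules -/

/-- A `C`-`D`-bicomodule: a left `C`-comodule and right `D`-comodule whose left coaction
`X → C ⊗ X` is right `D`-colinear. -/
structure Bicomod (R : Type u) [CommRing R] (C D : Type u) [AddCommGroup C] [Module R C]
    [Coalgebra R C] [AddCommGroup D] [Module R D] [Coalgebra R D] where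
  right : RightComod R D
  coactLeft : right.carrier →ₗ[R] C ⊗[R] right.carrier
  coassocLeft : (TensorProduct.assoc R C C right.carrier).toLinearMap ∘ₗ
    (Coalgebra.comul (R := R) (A := C)).rTensor right.carrier ∘ₗ coactLeft =
      coactLeft.lTensor C ∘ₗ coactLeft
  counitLeft : (Coalgebra.counit (R := R) (A := C)).rTensor right.carrier ∘ₗ coactLeft =
    TensorProduct.mk R R right.carrier 1
  colinear : (RightComod.tensor C right).coact ∘ₗ coactLeft =
    coactLeft.rTensor D ∘ₗ right.coact

/-- The underlying left comodule of a bicomodule. -/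
def Bicomod.left {R : Type u} [CommRing R] {C D : Type u} [AddCommGroup C] [Module R C]
    [Coalgebra R C] [AddCommGroup D] [Module R D] [Coalgebra R D] (X : Bicomod R C D) :
    LeftComod R C where
  carrier := X.right.carrier
  coact := X.coactLeft
  coassoc := X.coassocLeft
  counit_coact := X.counitLeft

/-! ### The bicomodule structure on the image of `C` under an equivalence -/

namespace RightComod

section Comparison

variable {R : Type u} [CommRing R] {C D : Type u} [AddCommGroup C] [Module R C] [Coalgebra R C]
  [AddCommGroup D] [Module R D] [Coalgebra R D]
  {V W : Type u} [AddCommGroup V] [Module R V] [AddCommGroup W] [Module R W]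

/-- The colinear map `W ⊗ M ⟶ N`, `w ⊗ m ↦ φ w m`, for an `R`-linear family `φ` of colinear maps
`M ⟶ N`. -/
def tensorDesc {M N : RightComod R C}
    (φ : W →ₗ[R] (M ⟶ N)) : tensor W M ⟶ N where
  lin := TensorProduct.lift
    { toFun := fun w => (φ w).lin
      map_add' := fun v w => by rw [map_add, add_lin]
      map_smul' := fun r w => by rw [map_smul, smul_lin, RingHom.id_apply] }
  colinear := by
    refine TensorProduct.ext' fun w m => ?_
    have h := LinearMap.congr_fun (φ w).colinear m
    simp only [LinearMap.comp_apply, Coact.right_tmul, TensorProduct.lift.tmul,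
      LinearMap.coe_mk, AddHom.coe_mk] at h ⊢
    rw [h]
    generalize M.coact m = y
    induction y <;> simp_all [TensorProduct.tmul_add]

theorem insert_tensorDesc {M N : RightComod R C}
    (φ : W →ₗ[R] (M ⟶ N)) (w : W) : insert w M ≫ tensorDesc φ = φ w := by
  ext m
  simp [insert, tensorDesc]

theorem tensor_hom_ext {M N : RightComod R C}
    {f g : tensor W M ⟶ N} (h : ∀ w : W, insert w M ≫ f = insert w M ≫ g) : f = g :=
  hom_ext (TensorProduct.ext' fun w m => LinearMap.congr_fun (congrArg Hom.lin (h w)) m)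

/-- The linear map `w ↦ (m ↦ w ⊗ m)`. -/
def insertLinear (W : Type u) [AddCommGroup W] [Module R W] (M : RightComod R C) :
    W →ₗ[R] (M ⟶ tensor W M) where
  toFun w := insert w M
  map_add' v w := hom_ext (map_add (TensorProduct.mk R W M.carrier) v w)
  map_smul' r w := hom_ext (map_smul (TensorProduct.mk R W M.carrier) r w)

/-- The canonical natural map `λ : W ⊗ F(M) ⟶ F(W ⊗ M)`, `w ⊗ x ↦ F(m ↦ w ⊗ m)(x)`, of an
`R`-linear functor `F`. -/
def comparison (F : RightComod R C ⥤ RightComod R D) [F.Additive] [F.Linear R]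
    (W : Type u) [AddCommGroup W] [Module R W] (M : RightComod R C) :
    tensor W (F.obj M) ⟶ F.obj (tensor W M) :=
  tensorDesc (F.mapLinearMap R ∘ₗ insertLinear W M)

theorem insert_comparison (F : RightComod R C ⥤ RightComod R D) [F.Additive] [F.Linear R]
    (w : W) (M : RightComod R C) :
    insert w (F.obj M) ≫ comparison F W M = F.map (insert w M) :=
  insert_tensorDesc _ w

theorem insert_tensorMapLeft (g : V →ₗ[R] W) (M : RightComod R C) (v : V) :
    insert v M ≫ tensorMapLeft g M = insert (g v) M := rfl

theorem insert_tensorMapRight {M N : RightComod R C}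
    (f : M ⟶ N) (w : W) : insert w M ≫ tensorMapRight W f = f ≫ insert w N := rfl

theorem insert_insert
    (v : V) (w : W) (M : RightComod R C) :
    insert w M ≫ insert v (tensor W M) ≫ tensorAssocInv V W M = insert (v ⊗ₜ[R] w) M := rfl

theorem comparison_natural_left (F : RightComod R C ⥤ RightComod R D) [F.Additive] [F.Linear R]
    (g : V →ₗ[R] W)
    (M : RightComod R C) :
    tensorMapLeft g (F.obj M) ≫ comparison F W M =
      comparison F V M ≫ F.map (tensorMapLeft g M) := by
  refine tensor_hom_ext fun v => ?_
  rw [← Category.assoc, insert_tensorMapLeft, insert_comparison, ← Category.assoc,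
    insert_comparison, ← F.map_comp, insert_tensorMapLeft]

theorem comparison_natural_right (F : RightComod R C ⥤ RightComod R D) [F.Additive] [F.Linear R]
    (W : Type u) [AddCommGroup W] [Module R W] {M N : RightComod R C} (f : M ⟶ N) :
    tensorMapRight W (F.map f) ≫ comparison F W N =
      comparison F W M ≫ F.map (tensorMapRight W f) := by
  refine tensor_hom_ext fun w => ?_
  rw [← Category.assoc, insert_tensorMapRight, Category.assoc, insert_comparison,
    ← Category.assoc, insert_comparison, ← F.map_comp, ← F.map_comp, insert_tensorMapRight]

theorem comparison_assoc (F : RightComod R C ⥤ RightComod R D) [F.Additive] [F.Linear R]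
    (V W : Type u) [AddCommGroup V] [Module R V] [AddCommGroup W] [Module R W]
    (M : RightComod R C) :
    tensorAssocInv V W (F.obj M) ≫ comparison F (V ⊗[R] W) M =
      tensorMapRight V (comparison F W M) ≫ comparison F V (tensor W M) ≫
        F.map (tensorAssocInv V W M) := by
  refine tensor_hom_ext fun v => tensor_hom_ext fun w => ?_
  have h1 : insert w (F.obj M) ≫ insert v (tensor W (F.obj M)) ≫ tensorAssocInv V W (F.obj M) ≫
      comparison F (V ⊗[R] W) M = F.map (insert (v ⊗ₜ[R] w) M) := by
    rw [← insert_comparison, ← insert_insert, Category.assoc, Category.assoc]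
  rw [h1, ← Category.assoc (insert v _), insert_tensorMapRight, Category.assoc,
    ← Category.assoc (insert w _), insert_comparison, ← Category.assoc (insert v _),
    insert_comparison, ← F.map_comp, ← F.map_comp, insert_insert]

/-- For an equivalence the canonical map `λ` is an isomorphism. -/
instance comparison_isIso (E : RightComod R C ≌ RightComod R D) [E.functor.Additive]
    [E.functor.Linear R] (W : Type u) [AddCommGroup W] [Module R W] (M : RightComod R C) :
    IsIso (comparison E.functor W M) := by
  let φ : W →ₗ[R] (M ⟶ E.inverse.obj (tensor W (E.functor.obj M))) :=
    Linear.leftComp R _ (E.toAdjunction.unit.app M) ∘ₗ E.inverse.mapLinearMap R ∘ₗ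
      insertLinear W (E.functor.obj M)
  have hφ : ∀ w, insert w M ≫ tensorDesc φ =
      E.toAdjunction.homEquiv _ _ (insert w (E.functor.obj M)) := fun w => by
    rw [insert_tensorDesc, Adjunction.homEquiv_unit]
    rfl
  refine ⟨(E.toAdjunction.homEquiv _ _).symm (tensorDesc φ), ?_, ?_⟩
  · refine tensor_hom_ext fun w => ?_
    rw [← Category.assoc, insert_comparison, ← Adjunction.homEquiv_naturality_left_symm, hφ,
      Equiv.symm_apply_apply, Category.comp_id]
  · apply (E.toAdjunction.homEquiv _ _).injective
    rw [Adjunction.homEquiv_naturality_right, Equiv.apply_symm_apply]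
    refine tensor_hom_ext fun w => ?_
    rw [← Category.assoc, hφ, ← Adjunction.homEquiv_naturality_right, insert_comparison,
      ← Adjunction.homEquiv_naturality_left, Category.comp_id]

/-- The comultiplication as a colinear map `C ⟶ C ⊗ C`. -/
def regularComul (R : Type u) [CommRing R] (C : Type u) [AddCommGroup C] [Module R C]
    [Coalgebra R C] : regular R C ⟶ tensor C (regular R C) where
  lin := Coalgebra.comul (R := R) (A := C)
  colinear := Coalgebra.coassoc_symm (R := R) (A := C)

theorem regularComul_coassoc (R : Type u) [CommRing R] (C : Type u) [AddCommGroup C] [Module R C]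
    [Coalgebra R C] :
    regularComul R C ≫ tensorMapLeft (Coalgebra.comul (R := R) (A := C)) (regular R C) =
      regularComul R C ≫ tensorMapRight C (regularComul R C) ≫
        tensorAssocInv C C (regular R C) :=
  hom_ext (Coalgebra.coassoc_symm (R := R) (A := C)).symm

theorem regularComul_counit (R : Type u) [CommRing R] (C : Type u) [AddCommGroup C] [Module R C]
    [Coalgebra R C] :
    regularComul R C ≫ tensorMapLeft (Coalgebra.counit (R := R) (A := C)) (regular R C) =
      insert (1 : R) (regular R C) :=
  hom_ext (Coalgebra.rTensor_counit_comp_comul (R := R) (A := C))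

/-- The left coaction `F(C) ⟶ C ⊗ F(C)`: the unique map whose composite with the canonical
isomorphism `λ : C ⊗ F(C) ⟶ F(C ⊗ C)` is `F(Δ)`. -/
noncomputable def imageCoact (E : RightComod R C ≌ RightComod R D) [E.functor.Additive]
    [E.functor.Linear R] :
    E.functor.obj (regular R C) ⟶ tensor C (E.functor.obj (regular R C)) :=
  E.functor.map (regularComul R C) ≫ inv (comparison E.functor C (regular R C))

theorem imageCoact_comparison (E : RightComod R C ≌ RightComod R D) [E.functor.Additive]
    [E.functor.Linear R] :
    imageCoact E ≫ comparison E.functor C (regular R C) = E.functor.map (regularComul R C) := by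
  rw [imageCoact, Category.assoc, IsIso.inv_hom_id, Category.comp_id]

theorem imageCoact_coassoc (E : RightComod R C ≌ RightComod R D) [E.functor.Additive]
    [E.functor.Linear R] :
    imageCoact E ≫ tensorMapLeft Coalgebra.comul (E.functor.obj (regular R C)) =
      imageCoact E ≫ tensorMapRight C (imageCoact E) ≫
        tensorAssocInv C C (E.functor.obj (regular R C)) := by
  rw [← cancel_mono (comparison E.functor (C ⊗[R] C) (regular R C))]
  simp only [Category.assoc]
  rw [comparison_natural_left, ← Category.assoc, imageCoact_comparison, comparison_assoc,
    ← Category.assoc (tensorMapRight C (imageCoact E))]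
  have h : tensorMapRight C (imageCoact E) ≫
      tensorMapRight C (comparison E.functor C (regular R C)) =
      tensorMapRight C (E.functor.map (regularComul R C)) := by
    rw [← imageCoact_comparison]
    exact hom_ext (LinearMap.lTensor_comp _ _ _).symm
  rw [h, ← Category.assoc (tensorMapRight C _), comparison_natural_right, Category.assoc,
    ← Category.assoc, imageCoact_comparison, ← E.functor.map_comp, ← E.functor.map_comp,
    ← E.functor.map_comp]
  rw [regularComul_coassoc]

theorem imageCoact_counit (E : RightComod R C ≌ RightComod R D) [E.functor.Additive]
    [E.functor.Linear R] :
    imageCoact E ≫ tensorMapLeft Coalgebra.counit (E.functor.obj (regular R C)) =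
      insert (1 : R) (E.functor.obj (regular R C)) := by
  rw [← cancel_mono (comparison E.functor R (regular R C)), Category.assoc,
    comparison_natural_left, ← Category.assoc, imageCoact_comparison, insert_comparison,
    ← E.functor.map_comp, regularComul_counit]

/-- The `C`-`D`-bicomodule `F(C)` of an `R`-linear equivalence `F` from right `C`-comodules to
right `D`-comodules. -/
noncomputable def _root_.imageBicomod (E : RightComod R C ≌ RightComod R D) [E.functor.Additive]
    [E.functor.Linear R] : Bicomod R C D where
  right := E.functor.obj (regular R C)
  coactLeft := (imageCoact E).lin
  coassocLeft := by
    have h : Coalgebra.comul.rTensor _ ∘ₗ (imageCoact E).lin =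
        (TensorProduct.assoc R C C _).symm.toLinearMap ∘ₗ
          (imageCoact E).lin.lTensor C ∘ₗ (imageCoact E).lin :=
      congrArg Hom.lin (imageCoact_coassoc E)
    rw [h, ← LinearMap.comp_assoc, LinearEquiv.comp_symm, LinearMap.id_comp]
  counitLeft := congrArg Hom.lin (imageCoact_counit E)
  colinear := (imageCoact E).colinear

instance symm_functor_additive (E : RightComod R C ≌ RightComod R D) [E.functor.Additive] :
    E.symm.functor.Additive :=
  inferInstanceAs E.inverse.Additive

instance symm_functor_linear (E : RightComod R C ≌ RightComod R D) [E.functor.Additive]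
    [E.functor.Linear R] : E.symm.functor.Linear R :=
  inferInstanceAs (E.inverse.Linear R)

end Comparison
end RightComod

/-!
Since `F` commutes with `W ⊗ -`, the functor `- ⊗ F(C)` is the cofree functor `- ⊗ C` followed by
`F`. It is therefore right adjoint to `G` followed by the forgetful functor, which is exact because
`C` is flat, so `F(C)` is quasi-finite and an injector. The coaction `F(C) ⟶ C ⊗ F(C)` is the image
of the comultiplication of `C` and inherits its universal property, whence `e_D(F(C)) ≅ C`.

On the left side, the coaction makes `M` the split equalizer of two maps `M ⊗ C ⟶ M ⊗ C ⊗ C`, and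
applying `F` to it shows `F(M) ≅ M □ F(C)`; this gives left faithful coflatness. For `M = G(D)` it
reads `D ≅ G(D) □ F(C)`. As the isomorphism is available for every `W ⊗ M`, the cotensor product
commutes with tensoring by arbitrary modules, and this purity makes `F(C) □ -` and `G(D) □ -`
mutually inverse equivalences of left comodule categories. The functor `F(C) □ -` then yields, for
the left structure, what `F` yields for the right one, and its exactness and faithfulness are the
right faithful coflatness of `F(C)`.
-/

/-! ### Split equalizers and exactness -/

section SplitEqualizer

variable {R A B P : Type*} [CommRing R] [AddCommGroup A] [Module R A] [AddCommGroup B] [Module R B]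
  [AddCommGroup P] [Module R P] {i : A →ₗ[R] B} {f g : B →ₗ[R] P}

/-- `i` is the split equalizer of `f` and `g`: besides `f ∘ i = g ∘ i` there are linear maps `r`
and `t` in the opposite directions with `r ∘ i = id`, `t ∘ f = i ∘ r` and `t ∘ g = id`. Unlike
exactness of `i` and `f - g`, these identities survive every additive functor, in particular
tensoring with a module that is not flat. -/
structure LinearSplitEqualizer (i : A →ₗ[R] B) (f g : B →ₗ[R] P) : Prop where
  comp_eq : f ∘ₗ i = g ∘ₗ i
  exists_splitting : ∃ (r : B →ₗ[R] A) (t : P →ₗ[R] B),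
    r ∘ₗ i = LinearMap.id ∧ t ∘ₗ f = i ∘ₗ r ∧ t ∘ₗ g = LinearMap.id

namespace LinearSplitEqualizer

theorem injective (h : LinearSplitEqualizer i f g) : Function.Injective i := by
  obtain ⟨r, -, hr, -, -⟩ := h.exists_splitting
  exact Function.LeftInverse.injective (LinearMap.congr_fun hr)

theorem exact_sub (h : LinearSplitEqualizer i f g) : Function.Exact i (f - g) := by
  obtain ⟨r, t, -, hf, hg⟩ := h.exists_splitting
  intro y
  rw [LinearMap.sub_apply, sub_eq_zero]
  constructor
  · intro hy
    exact ⟨r y, calc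
      i (r y) = t (f y) := (LinearMap.congr_fun hf y).symm
      _ = t (g y) := congrArg t hy
      _ = y := LinearMap.congr_fun hg y⟩
  · rintro ⟨x, rfl⟩
    exact LinearMap.congr_fun h.comp_eq x

theorem exact_sub_swap (h : LinearSplitEqualizer i f g) : Function.Exact i (g - f) := fun y => by
  rw [← h.exact_sub y, LinearMap.sub_apply, LinearMap.sub_apply, sub_eq_zero, sub_eq_zero, eq_comm]

theorem rTensor (h : LinearSplitEqualizer i f g) (W : Type*) [AddCommGroup W] [Module R W] :
    LinearSplitEqualizer (i.rTensor W) (f.rTensor W) (g.rTensor W) where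
  comp_eq := by rw [← LinearMap.rTensor_comp, ← LinearMap.rTensor_comp, h.comp_eq]
  exists_splitting := by
    obtain ⟨r, t, hr, hf, hg⟩ := h.exists_splitting
    refine ⟨r.rTensor W, t.rTensor W, ?_, ?_, ?_⟩ <;>
      simp only [← LinearMap.rTensor_comp, hr, hf, hg, LinearMap.rTensor_id]

theorem comp_linearEquiv {Q : Type*} [AddCommGroup Q] [Module R Q]
    (h : LinearSplitEqualizer i f g) (e : P ≃ₗ[R] Q) :
    LinearSplitEqualizer i (e.toLinearMap ∘ₗ f) (e.toLinearMap ∘ₗ g) where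
  comp_eq := by rw [LinearMap.comp_assoc, h.comp_eq, LinearMap.comp_assoc]
  exists_splitting := by
    obtain ⟨r, t, hr, hf, hg⟩ := h.exists_splitting
    refine ⟨r, t ∘ₗ e.symm.toLinearMap, hr, ?_, ?_⟩ <;>
      rw [LinearMap.comp_assoc, ← LinearMap.comp_assoc _ _ e.symm.toLinearMap,
        LinearEquiv.symm_comp, LinearMap.id_comp] <;> assumption

end LinearSplitEqualizer

end SplitEqualizer

section CounitMaps

variable (R : Type*) [CommRing R] (C : Type*) [AddCommGroup C] [Module R C] [Coalgebra R C]
  (W : Type*) [AddCommGroup W] [Module R W]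

/-- The map `W ⊗ C → W`, `w ⊗ c ↦ ε(c) w`. -/
def counitRight : W ⊗[R] C →ₗ[R] W :=
  (TensorProduct.rid R W).toLinearMap ∘ₗ (Coalgebra.counit (R := R) (A := C)).lTensor W

/-- The map `C ⊗ W → W`, `c ⊗ w ↦ ε(c) w`. -/
def counitLeft : C ⊗[R] W →ₗ[R] W :=
  (TensorProduct.lid R W).toLinearMap ∘ₗ (Coalgebra.counit (R := R) (A := C)).rTensor W

variable {W} {V : Type*} [AddCommGroup V] [Module R V]

theorem counitRight_naturality (f : V →ₗ[R] W) :
    counitRight R C W ∘ₗ f.rTensor C = f ∘ₗ counitRight R C V :=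
  TensorProduct.ext' fun v c => by simp [counitRight]

theorem counitLeft_naturality (f : V →ₗ[R] W) :
    counitLeft R C W ∘ₗ f.lTensor C = f ∘ₗ counitLeft R C V :=
  TensorProduct.ext' fun c v => by simp [counitLeft]

theorem counitRight_comul :
    counitRight R C C ∘ₗ Coalgebra.comul = LinearMap.id := by
  rw [counitRight, LinearMap.comp_assoc, Coalgebra.lTensor_counit_comp_comul]
  ext c
  simp

theorem counitLeft_comul :
    counitLeft R C C ∘ₗ Coalgebra.comul = LinearMap.id := by
  rw [counitLeft, LinearMap.comp_assoc, Coalgebra.rTensor_counit_comp_comul]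
  ext c
  simp

variable (W)

theorem counitRight_lTensor_comul :
    counitRight R C (W ⊗[R] C) ∘ₗ (TensorProduct.assoc R W C C).symm.toLinearMap ∘ₗ
      (Coalgebra.comul (R := R) (A := C)).lTensor W = LinearMap.id := by
  have h : counitRight R C (W ⊗[R] C) ∘ₗ (TensorProduct.assoc R W C C).symm.toLinearMap =
      (counitRight R C C).lTensor W := by
    ext
    simp [counitRight]
  rw [← LinearMap.comp_assoc, h, ← LinearMap.lTensor_comp, counitRight_comul,
    LinearMap.lTensor_id]

theorem rTensor_counitRight_lTensor_comul :
    (counitRight R C W).rTensor C ∘ₗ (TensorProduct.assoc R W C C).symm.toLinearMap ∘ₗ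
      (Coalgebra.comul (R := R) (A := C)).lTensor W = LinearMap.id := by
  have h : (counitRight R C W).rTensor C ∘ₗ (TensorProduct.assoc R W C C).symm.toLinearMap =
      (counitLeft R C C).lTensor W := by
    ext
    simp [counitRight, counitLeft, TensorProduct.smul_tmul]
  rw [← LinearMap.comp_assoc, h, ← LinearMap.lTensor_comp, counitLeft_comul,
    LinearMap.lTensor_id]

theorem counitLeft_rTensor_comul :
    counitLeft R C (C ⊗[R] W) ∘ₗ (TensorProduct.assoc R C C W).toLinearMap ∘ₗ
      (Coalgebra.comul (R := R) (A := C)).rTensor W = LinearMap.id := by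
  have h : counitLeft R C (C ⊗[R] W) ∘ₗ (TensorProduct.assoc R C C W).toLinearMap =
      (counitLeft R C C).rTensor W := by
    ext
    simp [counitLeft, TensorProduct.smul_tmul']
  rw [← LinearMap.comp_assoc, h, ← LinearMap.rTensor_comp, counitLeft_comul,
    LinearMap.rTensor_id]

theorem lTensor_counitLeft_rTensor_comul :
    (counitLeft R C W).lTensor C ∘ₗ (TensorProduct.assoc R C C W).toLinearMap ∘ₗ
      (Coalgebra.comul (R := R) (A := C)).rTensor W = LinearMap.id := by
  have h : (counitLeft R C W).lTensor C ∘ₗ (TensorProduct.assoc R C C W).toLinearMap =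
      (counitRight R C C).rTensor W := by
    ext
    simp [counitLeft, counitRight, TensorProduct.smul_tmul]
  rw [← LinearMap.comp_assoc, h, ← LinearMap.rTensor_comp, counitRight_comul,
    LinearMap.rTensor_id]

end CounitMaps

section ArrowExact

variable {𝒜 ℬ : Type*} [Category 𝒜] [Limits.HasZeroMorphisms 𝒜] [Category ℬ]
  [Limits.HasZeroMorphisms ℬ] {R : Type u} [Ring R]

/-- Exactness of `f ≫ g` at the middle object, phrased with arrows only and therefore transported
by equivalences of categories: arrows killed by `g` and arrows killing `f` compose to zero. In an
abelian category, taking `ker g` and `coker f` recovers exactness in the usual sense. -/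
def ArrowExact {X Y Z : 𝒜} (f : X ⟶ Y) (g : Y ⟶ Z) : Prop :=
  f ≫ g = 0 ∧ ∀ ⦃T Q : 𝒜⦄ (h : T ⟶ Y) (u : Y ⟶ Q), h ≫ g = 0 → f ≫ u = 0 → h ≫ u = 0

theorem ArrowExact.map {X Y Z : 𝒜} {f : X ⟶ Y} {g : Y ⟶ Z} (h : ArrowExact f g) (F : 𝒜 ⥤ ℬ)
    [F.IsEquivalence] : ArrowExact (F.map f) (F.map g) := by
  refine ⟨by rw [← F.map_comp, h.1, F.map_zero], fun T Q a u ha hu => ?_⟩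
  let eT := F.objObjPreimageIso T
  let eQ := F.objObjPreimageIso Q
  have hzero := congrArg F.map (h.2 (F.preimage (eT.hom ≫ a)) (F.preimage (u ≫ eQ.inv))
    (F.map_injective (by simp [ha])) (F.map_injective (by simp [← Category.assoc, hu])))
  simp only [F.map_comp, F.map_preimage, F.map_zero, Category.assoc] at hzero
  simpa using eT.inv ≫= hzero =≫ eQ.hom

/-- A functor to modules that lifts kernels and cokernels, in the weak sense that every arrow can
be continued to an exact sequence on both sides. -/
class LiftsKernelsAndCokernels (U : 𝒜 ⥤ ModuleCat.{u} R) : Prop extends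
    U.Faithful, U.PreservesZeroMorphisms where
  exists_kernel {X Y : 𝒜} (g : X ⟶ Y) :
    ∃ (K : 𝒜) (ι : K ⟶ X), Function.Exact (U.map ι).hom (U.map g).hom
  exists_cokernel {X Y : 𝒜} (f : X ⟶ Y) :
    ∃ (Q : 𝒜) (π : Y ⟶ Q), Function.Exact (U.map f).hom (U.map π).hom

variable (U : 𝒜 ⥤ ModuleCat.{u} R) (V : ℬ ⥤ ModuleCat.{u} R)

theorem map_comp_eq_zero_iff [U.Faithful] [U.PreservesZeroMorphisms] {X Y Z : 𝒜} (f : X ⟶ Y)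
    (g : Y ⟶ Z) : f ≫ g = 0 ↔ (U.map g).hom ∘ₗ (U.map f).hom = 0 := by
  rw [← ModuleCat.hom_comp, ← U.map_comp, ← ModuleCat.hom_zero, ← ModuleCat.hom_ext_iff,
    U.map_eq_zero_iff]

theorem arrowExact_of_exact_map [U.Faithful] [U.PreservesZeroMorphisms] {X Y Z : 𝒜} {f : X ⟶ Y}
    {g : Y ⟶ Z} (h : Function.Exact (U.map f).hom (U.map g).hom) : ArrowExact f g := by
  simp only [ArrowExact, map_comp_eq_zero_iff U]
  refine ⟨h.linearMap_comp_eq_zero, fun T Q a u ha hu => LinearMap.ext fun t => ?_⟩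
  obtain ⟨x, hx⟩ := (h ((U.map a).hom t)).1 (LinearMap.congr_fun ha t)
  rw [LinearMap.comp_apply, ← hx]
  exact LinearMap.congr_fun hu x

theorem ArrowExact.exact_map {X Y Z : 𝒜} {f : X ⟶ Y} {g : Y ⟶ Z} (h : ArrowExact f g)
    [LiftsKernelsAndCokernels U] : Function.Exact (U.map f).hom (U.map g).hom := by
  obtain ⟨K, ι, hι⟩ := LiftsKernelsAndCokernels.exists_kernel (U := U) g
  obtain ⟨Q, π, hπ⟩ := LiftsKernelsAndCokernels.exists_cokernel (U := U) f
  simp only [ArrowExact, map_comp_eq_zero_iff U] at h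
  have hιπ := h.2 ι π hι.linearMap_comp_eq_zero hπ.linearMap_comp_eq_zero
  refine LinearMap.exact_of_comp_of_mem_range h.1 fun y hy => ?_
  obtain ⟨k, rfl⟩ := (hι y).1 hy
  exact (hπ _).1 (LinearMap.congr_fun hιπ k)

theorem exact_map_of_isEquivalence [U.Faithful] [U.PreservesZeroMorphisms]
    [LiftsKernelsAndCokernels V] (F : 𝒜 ⥤ ℬ) [F.IsEquivalence] {X Y Z : 𝒜} {f : X ⟶ Y} {g : Y ⟶ Z}
    (h : Function.Exact (U.map f).hom (U.map g).hom) :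
    Function.Exact (V.map (F.map f)).hom (V.map (F.map g)).hom :=
  ((arrowExact_of_exact_map U h).map F).exact_map V

instance LiftsKernelsAndCokernels.preservesMonomorphisms [LiftsKernelsAndCokernels U] :
    U.PreservesMonomorphisms where
  preserves {X Y} g _ := by
    obtain ⟨K, ι, hι⟩ := LiftsKernelsAndCokernels.exists_kernel (U := U) g
    have hι_zero : ι = 0 := by
      rw [← cancel_mono g, Limits.zero_comp, map_comp_eq_zero_iff U]
      exact hι.linearMap_comp_eq_zero
    rw [ModuleCat.mono_iff_injective, injective_iff_map_eq_zero]
    intro x hx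
    obtain ⟨k, rfl⟩ := (hι x).1 hx
    rw [hι_zero, U.map_zero]
    rfl

end ArrowExact

/-! ### Kernels, cokernels and cofree comodules -/

namespace Coact

section Naturality

variable {R C M N P : Type*} [CommRing R] [AddCommGroup C] [Module R C] [AddCommGroup M]
  [Module R M] [AddCommGroup N] [Module R N] [AddCommGroup P] [Module R P] {f : M →ₗ[R] N}

theorem rTensor_comp_right_twice {ρ : M →ₗ[R] M ⊗[R] C} {σ : N →ₗ[R] N ⊗[R] C}
    (h : σ ∘ₗ f = f.rTensor C ∘ₗ ρ) :
    f.rTensor (C ⊗[R] C) ∘ₗ (TensorProduct.assoc R M C C).toLinearMap ∘ₗ ρ.rTensor C ∘ₗ ρ =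
      ((TensorProduct.assoc R N C C).toLinearMap ∘ₗ σ.rTensor C ∘ₗ σ) ∘ₗ f := by
  have hassoc : f.rTensor (C ⊗[R] C) ∘ₗ (TensorProduct.assoc R M C C).toLinearMap =
      (TensorProduct.assoc R N C C).toLinearMap ∘ₗ (f.rTensor C).rTensor C :=
    TensorProduct.ext_threefold fun _ _ _ => rfl
  simp only [LinearMap.comp_assoc, h]
  rw [← LinearMap.comp_assoc, hassoc, LinearMap.comp_assoc, ← LinearMap.comp_assoc ρ,
    ← LinearMap.rTensor_comp, ← h, LinearMap.rTensor_comp, LinearMap.comp_assoc, h]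

theorem rTensor_comp_lTensor_right {ρ : M →ₗ[R] M ⊗[R] C} {σ : N →ₗ[R] N ⊗[R] C}
    (h : σ ∘ₗ f = f.rTensor C ∘ₗ ρ) (φ : C →ₗ[R] P) :
    f.rTensor P ∘ₗ φ.lTensor M ∘ₗ ρ = (φ.lTensor N ∘ₗ σ) ∘ₗ f := by
  rw [LinearMap.comp_assoc, h, ← LinearMap.comp_assoc, ← LinearMap.comp_assoc,
    LinearMap.rTensor_comp_lTensor, LinearMap.lTensor_comp_rTensor]

theorem lTensor_comp_left_twice {ρ : M →ₗ[R] C ⊗[R] M} {σ : N →ₗ[R] C ⊗[R] N}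
    (h : σ ∘ₗ f = f.lTensor C ∘ₗ ρ) :
    (f.lTensor C).lTensor C ∘ₗ ρ.lTensor C ∘ₗ ρ = (σ.lTensor C ∘ₗ σ) ∘ₗ f := by
  rw [LinearMap.comp_assoc, h, ← LinearMap.comp_assoc, ← LinearMap.comp_assoc,
    ← LinearMap.lTensor_comp, ← LinearMap.lTensor_comp, h]

theorem lTensor_comp_assoc_rTensor_left {ρ : M →ₗ[R] C ⊗[R] M} {σ : N →ₗ[R] C ⊗[R] N}
    (h : σ ∘ₗ f = f.lTensor C ∘ₗ ρ) (Δ : C →ₗ[R] C ⊗[R] C) :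
    (f.lTensor C).lTensor C ∘ₗ (TensorProduct.assoc R C C M).toLinearMap ∘ₗ Δ.rTensor M ∘ₗ ρ =
      ((TensorProduct.assoc R C C N).toLinearMap ∘ₗ Δ.rTensor N ∘ₗ σ) ∘ₗ f := by
  have hassoc : (f.lTensor C).lTensor C ∘ₗ (TensorProduct.assoc R C C M).toLinearMap =
      (TensorProduct.assoc R C C N).toLinearMap ∘ₗ f.lTensor (C ⊗[R] C) :=
    TensorProduct.ext_threefold fun _ _ _ => rfl
  simp only [LinearMap.comp_assoc, h]
  rw [← LinearMap.comp_assoc, hassoc, LinearMap.comp_assoc, ← LinearMap.comp_assoc ρ,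
    LinearMap.lTensor_comp_rTensor, ← LinearMap.rTensor_comp_lTensor, LinearMap.comp_assoc]

theorem lTensor_comp_rTensor_left {ρ : M →ₗ[R] C ⊗[R] M} {σ : N →ₗ[R] C ⊗[R] N}
    (h : σ ∘ₗ f = f.lTensor C ∘ₗ ρ) (φ : C →ₗ[R] P) :
    f.lTensor P ∘ₗ φ.rTensor M ∘ₗ ρ = (φ.rTensor N ∘ₗ σ) ∘ₗ f := by
  rw [LinearMap.comp_assoc, h, ← LinearMap.comp_assoc, ← LinearMap.comp_assoc,
    LinearMap.rTensor_comp_lTensor, LinearMap.lTensor_comp_rTensor]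

end Naturality

end Coact

namespace RightComod

section Forgetful

variable {R : Type u} [CommRing R] {C : Type u} [AddCommGroup C] [Module R C] [Coalgebra R C]

theorem sub_lin {M N : RightComod R C} (f g : M ⟶ N) : (f - g).lin = f.lin - g.lin := by
  rw [sub_eq_add_neg, sub_eq_add_neg]
  rfl

/-- The forgetful functor from right comodules to modules. -/
def forgetful (R : Type u) [CommRing R] (C : Type u) [AddCommGroup C] [Module R C]
    [Coalgebra R C] : RightComod R C ⥤ ModuleCat.{u} R where
  obj M := ModuleCat.of R M.carrier
  map f := ModuleCat.ofHom f.lin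

instance forgetful_faithful : (forgetful R C).Faithful where
  map_injective h := hom_ext (ModuleCat.hom_ext_iff.1 h)

instance forgetful_preservesZeroMorphisms : (forgetful R C).PreservesZeroMorphisms where

theorem coact_subtype_ker_mem_range [Module.Flat R C] {M N : RightComod R C} (g : M ⟶ N)
    (k : LinearMap.ker g.lin) :
    (M.coact ∘ₗ (LinearMap.ker g.lin).subtype) k ∈
      LinearMap.range ((LinearMap.ker g.lin).subtype.rTensor C) := by
  refine (Module.Flat.rTensor_exact C g.lin.exact_subtype_ker_map _).1 ?_
  rw [LinearMap.comp_apply, ← LinearMap.comp_apply, ← g.colinear, LinearMap.comp_apply]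
  exact (congrArg _ k.2).trans (map_zero _)

/-- The kernel of a colinear map; flatness of `C` makes `ker g ⊗ C → M ⊗ C` injective with image
the kernel of `g ⊗ C`. -/
noncomputable def ker [Module.Flat R C] {M N : RightComod R C} (g : M ⟶ N) : RightComod R C :=
  let i := (LinearMap.ker g.lin).subtype
  have hi (V : Type u) [AddCommGroup V] [Module R V] [Module.Flat R V] :
      Function.Injective (i.rTensor V) :=
    Module.Flat.rTensor_preserves_injective_linearMap i (Submodule.subtype_injective _)
  have hcoact := (LinearMap.codRestrictOfInjective_comp (M.coact ∘ₗ i) (i.rTensor C) (hi C)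
    (coact_subtype_ker_mem_range g)).symm
  { carrier := LinearMap.ker g.lin
    coact := LinearMap.codRestrictOfInjective (M.coact ∘ₗ i) (i.rTensor C) (hi C)
      (coact_subtype_ker_mem_range g)
    coassoc := by
      rw [← LinearMap.cancel_left (hi (C ⊗[R] C)), Coact.rTensor_comp_right_twice hcoact,
        M.coassoc, Coact.rTensor_comp_lTensor_right hcoact]
    counit_coact := by
      rw [← LinearMap.cancel_left (hi R), Coact.rTensor_comp_lTensor_right hcoact, M.counit_coact]
      rfl }

/-- The inclusion of the kernel of a colinear map. -/
noncomputable def kerι [Module.Flat R C] {M N : RightComod R C} (g : M ⟶ N) : ker g ⟶ M where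
  lin := (LinearMap.ker g.lin).subtype
  colinear := (LinearMap.codRestrictOfInjective_comp _ _ _ _).symm

theorem range_le_ker_mkQ_comp_coact {M N : RightComod R C} (f : M ⟶ N) :
    LinearMap.range f.lin ≤
      LinearMap.ker ((LinearMap.range f.lin).mkQ.rTensor C ∘ₗ N.coact) := by
  rw [LinearMap.range_le_ker_iff, LinearMap.comp_assoc, f.colinear, ← LinearMap.comp_assoc,
    ← LinearMap.rTensor_comp, LinearMap.range_mkQ_comp, LinearMap.rTensor_zero,
    LinearMap.zero_comp]

/-- The cokernel of a colinear map. -/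
noncomputable def coker {M N : RightComod R C} (f : M ⟶ N) : RightComod R C :=
  let p := (LinearMap.range f.lin).mkQ
  have hp := Submodule.mkQ_surjective (LinearMap.range f.lin)
  have hcoact := (LinearMap.range f.lin).liftQ_mkQ _ (range_le_ker_mkQ_comp_coact f)
  { carrier := N.carrier ⧸ LinearMap.range f.lin
    coact := (LinearMap.range f.lin).liftQ (p.rTensor C ∘ₗ N.coact) (range_le_ker_mkQ_comp_coact f)
    coassoc := by
      rw [← LinearMap.cancel_right hp, ← Coact.rTensor_comp_right_twice hcoact, N.coassoc,
        Coact.rTensor_comp_lTensor_right hcoact]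
    counit_coact := by
      rw [← LinearMap.cancel_right hp, ← Coact.rTensor_comp_lTensor_right hcoact, N.counit_coact]
      rfl }

/-- The projection onto the cokernel of a colinear map. -/
noncomputable def cokerπ {M N : RightComod R C} (f : M ⟶ N) : N ⟶ coker f where
  lin := (LinearMap.range f.lin).mkQ
  colinear := (LinearMap.range f.lin).liftQ_mkQ _ _

instance forgetful_liftsKernelsAndCokernels [Module.Flat R C] :
    LiftsKernelsAndCokernels (forgetful R C) where
  exists_kernel g := ⟨ker g, kerι g, g.lin.exact_subtype_ker_map⟩
  exists_cokernel f := ⟨coker f, cokerπ f, f.lin.exact_map_mkQ_range⟩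

theorem mono_of_injective {M N : RightComod R C} {f : M ⟶ N} (hf : Function.Injective f.lin) :
    Mono f :=
  (forgetful R C).mono_of_mono_map ((ModuleCat.mono_iff_injective _).2 hf)

theorem injective_of_mono [Module.Flat R C] {M N : RightComod R C} (f : M ⟶ N) [Mono f] :
    Function.Injective f.lin :=
  (ModuleCat.mono_iff_injective _).1 ((forgetful R C).map_mono f)

theorem counitRight_coact (M : RightComod R C) :
    counitRight R C M.carrier ∘ₗ M.coact = LinearMap.id := by
  rw [counitRight, LinearMap.comp_assoc, M.counit_coact]
  ext x
  simp

theorem linearSplitEqualizer_coact (M : RightComod R C) :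
    LinearSplitEqualizer M.coact (M.coact.rTensor C)
      ((TensorProduct.assoc R M.carrier C C).symm.toLinearMap ∘ₗ
        (Coalgebra.comul (R := R) (A := C)).lTensor M.carrier) where
  comp_eq := by
    rw [LinearMap.comp_assoc, ← M.coassoc, ← LinearMap.comp_assoc, LinearEquiv.symm_comp,
      LinearMap.id_comp]
  exists_splitting := ⟨counitRight R C _, counitRight R C _, counitRight_coact M,
    counitRight_naturality R C M.coact, counitRight_lTensor_comul R C M.carrier⟩

/-- The coaction of `M` as a colinear map `M ⟶ M ⊗ C`. -/
def coactHom (M : RightComod R C) : M ⟶ tensor M.carrier (regular R C) where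
  lin := M.coact
  colinear := M.linearSplitEqualizer_coact.comp_eq.symm

theorem coactHom_naturality {M N : RightComod R C} (f : M ⟶ N) :
    f ≫ coactHom N = coactHom M ≫ tensorMapLeft f.lin (regular R C) :=
  hom_ext f.colinear

/-- The cofree comodule functor `- ⊗ C` is right adjoint to the forgetful functor; the unit is the
coaction and the counit is given by the counit of `C`. -/
noncomputable def forgetfulAdj (R : Type u) [CommRing R] (C : Type u) [AddCommGroup C] [Module R C]
    [Coalgebra R C] : forgetful R C ⊣ (regular R C).tensorFunctor :=
  Adjunction.mkOfUnitCounit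
    { unit := { app := coactHom, naturality := fun _ _ f => coactHom_naturality f }
      counit :=
        { app W := ModuleCat.ofHom (counitRight R C W)
          naturality _ _ f := ModuleCat.hom_ext (counitRight_naturality R C f.hom) }
      left_triangle := by
        ext M : 2
        exact ModuleCat.hom_ext (counitRight_coact M)
      right_triangle := by
        ext W : 2
        exact hom_ext (rTensor_counitRight_lTensor_comul R C W) }

end Forgetful

end RightComod

namespace LeftComod

section Forgetful

variable {R : Type u} [CommRing R] {C : Type u} [AddCommGroup C] [Module R C] [Coalgebra R C]

instance hasZeroMorphisms : Limits.HasZeroMorphisms (LeftComod R C) where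
  zero M N := ⟨⟨0, by simp⟩⟩
  comp_zero f _ := hom_ext (LinearMap.zero_comp f.lin)
  zero_comp _ _ _ f := hom_ext (LinearMap.comp_zero f.lin)

/-- The forgetful functor from left comodules to modules. -/
def forgetful (R : Type u) [CommRing R] (C : Type u) [AddCommGroup C] [Module R C]
    [Coalgebra R C] : LeftComod R C ⥤ ModuleCat.{u} R where
  obj M := ModuleCat.of R M.carrier
  map f := ModuleCat.ofHom f.lin

instance forgetful_faithful : (forgetful R C).Faithful where
  map_injective h := hom_ext (ModuleCat.hom_ext_iff.1 h)

instance forgetful_preservesZeroMorphisms : (forgetful R C).PreservesZeroMorphisms where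

theorem coact_subtype_ker_mem_range [Module.Flat R C] {M N : LeftComod R C} (g : M ⟶ N)
    (k : LinearMap.ker g.lin) :
    (M.coact ∘ₗ (LinearMap.ker g.lin).subtype) k ∈
      LinearMap.range ((LinearMap.ker g.lin).subtype.lTensor C) := by
  refine (Module.Flat.lTensor_exact C g.lin.exact_subtype_ker_map _).1 ?_
  rw [LinearMap.comp_apply, ← LinearMap.comp_apply, ← g.colinear, LinearMap.comp_apply]
  exact (congrArg _ k.2).trans (map_zero _)

/-- The kernel of a colinear map; flatness of `C` makes `C ⊗ ker g → C ⊗ M` injective with image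
the kernel of `C ⊗ g`. -/
noncomputable def ker [Module.Flat R C] {M N : LeftComod R C} (g : M ⟶ N) : LeftComod R C :=
  let i := (LinearMap.ker g.lin).subtype
  have hi (V : Type u) [AddCommGroup V] [Module R V] [Module.Flat R V] :
      Function.Injective (i.lTensor V) :=
    Module.Flat.lTensor_preserves_injective_linearMap i (Submodule.subtype_injective _)
  have hcoact := (LinearMap.codRestrictOfInjective_comp (M.coact ∘ₗ i) (i.lTensor C) (hi C)
    (coact_subtype_ker_mem_range g)).symm
  { carrier := LinearMap.ker g.lin
    coact := LinearMap.codRestrictOfInjective (M.coact ∘ₗ i) (i.lTensor C) (hi C)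
      (coact_subtype_ker_mem_range g)
    coassoc := by
      rw [← LinearMap.cancel_left (Module.Flat.lTensor_preserves_injective_linearMap _ (hi C)),
        Coact.lTensor_comp_assoc_rTensor_left hcoact, M.coassoc,
        Coact.lTensor_comp_left_twice hcoact]
    counit_coact := by
      rw [← LinearMap.cancel_left (hi R), Coact.lTensor_comp_rTensor_left hcoact, M.counit_coact]
      rfl }

/-- The inclusion of the kernel of a colinear map. -/
noncomputable def kerι [Module.Flat R C] {M N : LeftComod R C} (g : M ⟶ N) : ker g ⟶ M where
  lin := (LinearMap.ker g.lin).subtype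
  colinear := (LinearMap.codRestrictOfInjective_comp _ _ _ _).symm

theorem range_le_ker_mkQ_comp_coact {M N : LeftComod R C} (f : M ⟶ N) :
    LinearMap.range f.lin ≤
      LinearMap.ker ((LinearMap.range f.lin).mkQ.lTensor C ∘ₗ N.coact) := by
  rw [LinearMap.range_le_ker_iff, LinearMap.comp_assoc, f.colinear, ← LinearMap.comp_assoc,
    ← LinearMap.lTensor_comp, LinearMap.range_mkQ_comp, LinearMap.lTensor_zero,
    LinearMap.zero_comp]

/-- The cokernel of a colinear map. -/
noncomputable def coker {M N : LeftComod R C} (f : M ⟶ N) : LeftComod R C :=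
  let p := (LinearMap.range f.lin).mkQ
  have hp := Submodule.mkQ_surjective (LinearMap.range f.lin)
  have hcoact := (LinearMap.range f.lin).liftQ_mkQ _ (range_le_ker_mkQ_comp_coact f)
  { carrier := N.carrier ⧸ LinearMap.range f.lin
    coact := (LinearMap.range f.lin).liftQ (p.lTensor C ∘ₗ N.coact) (range_le_ker_mkQ_comp_coact f)
    coassoc := by
      rw [← LinearMap.cancel_right hp, ← Coact.lTensor_comp_assoc_rTensor_left hcoact, N.coassoc,
        Coact.lTensor_comp_left_twice hcoact]
    counit_coact := by
      rw [← LinearMap.cancel_right hp, ← Coact.lTensor_comp_rTensor_left hcoact, N.counit_coact]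
      rfl }

/-- The projection onto the cokernel of a colinear map. -/
noncomputable def cokerπ {M N : LeftComod R C} (f : M ⟶ N) : N ⟶ coker f where
  lin := (LinearMap.range f.lin).mkQ
  colinear := (LinearMap.range f.lin).liftQ_mkQ _ _

instance forgetful_liftsKernelsAndCokernels [Module.Flat R C] :
    LiftsKernelsAndCokernels (forgetful R C) where
  exists_kernel g := ⟨ker g, kerι g, g.lin.exact_subtype_ker_map⟩
  exists_cokernel f := ⟨coker f, cokerπ f, f.lin.exact_map_mkQ_range⟩

theorem mono_of_injective {M N : LeftComod R C} {f : M ⟶ N} (hf : Function.Injective f.lin) :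
    Mono f :=
  (forgetful R C).mono_of_mono_map ((ModuleCat.mono_iff_injective _).2 hf)

/-- The coalgebra `C` as a left comodule over itself. -/
def regular (R : Type u) [CommRing R] (C : Type u) [AddCommGroup C] [Module R C]
    [Coalgebra R C] : LeftComod R C where
  carrier := C
  coact := Coalgebra.comul
  coassoc := Coalgebra.coassoc
  counit_coact := Coalgebra.rTensor_counit_comp_comul

theorem counitLeft_coact (M : LeftComod R C) :
    counitLeft R C M.carrier ∘ₗ M.coact = LinearMap.id := by
  rw [counitLeft, LinearMap.comp_assoc, M.counit_coact]
  ext x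
  simp

theorem linearSplitEqualizer_coact (M : LeftComod R C) :
    LinearSplitEqualizer M.coact (M.coact.lTensor C)
      ((TensorProduct.assoc R C C M.carrier).toLinearMap ∘ₗ
        (Coalgebra.comul (R := R) (A := C)).rTensor M.carrier) where
  comp_eq := by rw [LinearMap.comp_assoc, M.coassoc]
  exists_splitting := ⟨counitLeft R C _, counitLeft R C _, counitLeft_coact M,
    counitLeft_naturality R C M.coact, counitLeft_rTensor_comul R C M.carrier⟩

theorem exact_coact_cotensorDiff (M : LeftComod R C) :
    Function.Exact M.coact (cotensorDiff (RightComod.regular R C) M) :=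
  M.linearSplitEqualizer_coact.exact_sub_swap

/-- The coaction of `M` as a colinear map `M ⟶ C ⊗ M`. -/
def coactHom (M : LeftComod R C) : M ⟶ tensor (regular R C) M.carrier where
  lin := M.coact
  colinear := M.coassoc

/-- The cofree comodule functor `C ⊗ -` is right adjoint to the forgetful functor; the unit is the
coaction and the counit is given by the counit of `C`. -/
noncomputable def forgetfulAdj (R : Type u) [CommRing R] (C : Type u) [AddCommGroup C] [Module R C]
    [Coalgebra R C] : forgetful R C ⊣ (regular R C).tensorFunctor :=
  Adjunction.mkOfUnitCounit
    { unit := { app := coactHom, naturality := fun _ _ f => hom_ext f.colinear }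
      counit :=
        { app W := ModuleCat.ofHom (counitLeft R C W)
          naturality _ _ f := ModuleCat.hom_ext (counitLeft_naturality R C f.hom) }
      left_triangle := by
        ext M : 2
        exact ModuleCat.hom_ext (counitLeft_coact M)
      right_triangle := by
        ext W : 2
        exact hom_ext (lTensor_counitLeft_rTensor_comul R C W) }

end Forgetful

end LeftComod

/-! ### Coendomorphism coalgebras -/

namespace RightComod

section Coend

variable {R : Type u} [CommRing R] {C D : Type u} [AddCommGroup C] [Module R C] [AddCommGroup D]
  [Module R D]

theorem map_rTensor_comp_assoc_symm {V M : Type*} [AddCommGroup V] [Module R V] [AddCommGroup M]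
    [Module R M] (φ : V →ₗ[R] C) (η : M →ₗ[R] V ⊗[R] M) :
    (TensorProduct.map φ φ).rTensor M ∘ₗ (TensorProduct.assoc R V V M).symm.toLinearMap ∘ₗ
        η.lTensor V =
      (TensorProduct.assoc R C C M).symm.toLinearMap ∘ₗ (φ.rTensor M ∘ₗ η).lTensor C ∘ₗ
        φ.rTensor M := by
  refine TensorProduct.ext' fun v m => ?_
  simp only [LinearMap.lTensor_tmul, LinearMap.rTensor_tmul, LinearMap.comp_apply,
    LinearEquiv.coe_coe]
  induction η m <;> simp_all [TensorProduct.tmul_add]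

variable [Coalgebra R D]

theorem exists_linearEquiv_coend_of_universal (X : RightComod R D) [X.QuasiFinite]
    (a : X ⟶ tensor C X)
    (universal : ∀ (W : Type u) [AddCommGroup W] [Module R W],
      Function.Bijective fun g : C →ₗ[R] W => a ≫ tensorMapLeft g X) :
    ∃ e : X.Coend ≃ₗ[R] C, e.toLinearMap.rTensor X.carrier ∘ₗ X.coendUnit.lin = a.lin := by
  let φ : X.Coend →ₗ[R] C := X.cohomDesc a
  have hφ : φ.rTensor X.carrier ∘ₗ X.coendUnit.lin = a.lin := X.cohomDesc_unit a
  obtain ⟨ψ, ha⟩ := (universal X.Coend).surjective X.coendUnit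
  have hψ : ψ.rTensor X.carrier ∘ₗ a.lin = X.coendUnit.lin := congrArg Hom.lin ha
  have hψφ : ψ ∘ₗ φ = LinearMap.id := X.coend_hom_ext _ _ <| by
    rw [LinearMap.rTensor_comp, LinearMap.comp_assoc, hφ, hψ, LinearMap.rTensor_id,
      LinearMap.id_comp]
  have hφψ : φ ∘ₗ ψ = LinearMap.id := (universal C).injective <| hom_ext <| by
    change (φ ∘ₗ ψ).rTensor X.carrier ∘ₗ a.lin = LinearMap.id.rTensor X.carrier ∘ₗ a.lin
    rw [LinearMap.rTensor_comp, LinearMap.comp_assoc, hψ, hφ, LinearMap.rTensor_id,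
      LinearMap.id_comp]
  exact ⟨LinearEquiv.ofLinearMap φ ψ hφψ hψφ, hφ⟩

variable [Coalgebra R C]

theorem nonempty_coend_coalgEquiv_of_universal (X : RightComod R D) [X.QuasiFinite]
    (a : X ⟶ tensor C X)
    (universal : ∀ (W : Type u) [AddCommGroup W] [Module R W],
      Function.Bijective fun g : C →ₗ[R] W => a ≫ tensorMapLeft g X)
    (coassoc : a ≫ tensorMapLeft Coalgebra.comul X =
      a ≫ tensorMapRight C a ≫ tensorAssocInv C C X)
    (counit : a ≫ tensorMapLeft Coalgebra.counit X = insert (1 : R) X) :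
    Nonempty (X.Coend ≃ₗc[R] C) := by
  obtain ⟨e, he⟩ := X.exists_linearEquiv_coend_of_universal a universal
  have coassoc_lin : Coalgebra.comul.rTensor X.carrier ∘ₗ a.lin =
      (TensorProduct.assoc R C C X.carrier).symm.toLinearMap ∘ₗ a.lin.lTensor C ∘ₗ a.lin :=
    congrArg Hom.lin coassoc
  have counit_lin : Coalgebra.counit.rTensor X.carrier ∘ₗ a.lin = (insert (1 : R) X).lin :=
    congrArg Hom.lin counit
  have coendComul_unit : X.coendComul.rTensor X.carrier ∘ₗ X.coendUnit.lin =
      (TensorProduct.assoc R X.Coend X.Coend X.carrier).symm.toLinearMap ∘ₗ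
        X.coendUnit.lin.lTensor X.Coend ∘ₗ X.coendUnit.lin := X.cohomDesc_unit _
  refine ⟨{ e with
    counit_comp := X.coend_hom_ext _ _ ?_, map_comp_comul := X.coend_hom_ext _ _ ?_ }⟩
  · change (Coalgebra.counit ∘ₗ e.toLinearMap).rTensor X.carrier ∘ₗ X.coendUnit.lin =
      X.coendCounit.rTensor X.carrier ∘ₗ X.coendUnit.lin
    rw [LinearMap.rTensor_comp, LinearMap.comp_assoc, he, counit_lin]
    exact (X.cohomDesc_unit (insert (1 : R) X)).symm
  · change (TensorProduct.map e.toLinearMap e.toLinearMap ∘ₗ X.coendComul).rTensor X.carrier ∘ₗ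
        X.coendUnit.lin =
      (Coalgebra.comul ∘ₗ e.toLinearMap).rTensor X.carrier ∘ₗ X.coendUnit.lin
    rw [LinearMap.rTensor_comp, LinearMap.rTensor_comp, LinearMap.comp_assoc, coendComul_unit,
      LinearMap.comp_assoc, he, coassoc_lin, ← he]
    exact congrArg (· ∘ₗ X.coendUnit.lin)
      (map_rTensor_comp_assoc_symm e.toLinearMap X.coendUnit.lin)

end Coend

end RightComod

namespace LeftComod

section Coend

variable {R : Type u} [CommRing R] {C D : Type u} [AddCommGroup C] [Module R C] [AddCommGroup D]
  [Module R D]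

theorem map_lTensor_comp_assoc {V M : Type*} [AddCommGroup V] [Module R V] [AddCommGroup M]
    [Module R M] (φ : V →ₗ[R] D) (η : M →ₗ[R] M ⊗[R] V) :
    (TensorProduct.map φ φ).lTensor M ∘ₗ (TensorProduct.assoc R M V V).toLinearMap ∘ₗ
        η.rTensor V =
      (TensorProduct.assoc R M D D).toLinearMap ∘ₗ (φ.lTensor M ∘ₗ η).rTensor D ∘ₗ
        φ.lTensor M := by
  refine TensorProduct.ext' fun m v => ?_
  simp only [LinearMap.lTensor_tmul, LinearMap.rTensor_tmul, LinearMap.comp_apply,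
    LinearEquiv.coe_coe]
  induction η m <;> simp_all [TensorProduct.add_tmul]

variable [Coalgebra R C]

theorem exists_linearEquiv_coend_of_universal (X : LeftComod R C) [X.QuasiFinite]
    (a : X ⟶ tensor X D)
    (universal : ∀ (W : Type u) [AddCommGroup W] [Module R W],
      Function.Bijective fun g : D →ₗ[R] W => a ≫ tensorMapRight X g) :
    ∃ e : X.Coend ≃ₗ[R] D, e.toLinearMap.lTensor X.carrier ∘ₗ X.coendUnit.lin = a.lin := by
  let φ : X.Coend →ₗ[R] D := X.cohomDesc a
  have hφ : φ.lTensor X.carrier ∘ₗ X.coendUnit.lin = a.lin := X.cohomDesc_unit a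
  obtain ⟨ψ, ha⟩ := (universal X.Coend).surjective X.coendUnit
  have hψ : ψ.lTensor X.carrier ∘ₗ a.lin = X.coendUnit.lin := congrArg Hom.lin ha
  have hψφ : ψ ∘ₗ φ = LinearMap.id := X.coend_hom_ext _ _ <| by
    rw [LinearMap.lTensor_comp, LinearMap.comp_assoc, hφ, hψ, LinearMap.lTensor_id,
      LinearMap.id_comp]
  have hφψ : φ ∘ₗ ψ = LinearMap.id := (universal D).injective <| hom_ext <| by
    change (φ ∘ₗ ψ).lTensor X.carrier ∘ₗ a.lin = LinearMap.id.lTensor X.carrier ∘ₗ a.lin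
    rw [LinearMap.lTensor_comp, LinearMap.comp_assoc, hψ, hφ, LinearMap.lTensor_id,
      LinearMap.id_comp]
  exact ⟨LinearEquiv.ofLinearMap φ ψ hφψ hψφ, hφ⟩

variable [Coalgebra R D]

theorem nonempty_coend_coalgEquiv_of_universal (X : LeftComod R C) [X.QuasiFinite]
    (a : X ⟶ tensor X D)
    (universal : ∀ (W : Type u) [AddCommGroup W] [Module R W],
      Function.Bijective fun g : D →ₗ[R] W => a ≫ tensorMapRight X g)
    (coassoc : a ≫ tensorMapRight X Coalgebra.comul =
      a ≫ tensorMapLeft a D ≫ tensorAssoc X D D)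
    (counit : a ≫ tensorMapRight X Coalgebra.counit = insert X (1 : R)) :
    Nonempty (X.Coend ≃ₗc[R] D) := by
  obtain ⟨e, he⟩ := X.exists_linearEquiv_coend_of_universal a universal
  have coassoc_lin : Coalgebra.comul.lTensor X.carrier ∘ₗ a.lin =
      (TensorProduct.assoc R X.carrier D D).toLinearMap ∘ₗ a.lin.rTensor D ∘ₗ a.lin :=
    congrArg Hom.lin coassoc
  have counit_lin : Coalgebra.counit.lTensor X.carrier ∘ₗ a.lin = (insert X (1 : R)).lin :=
    congrArg Hom.lin counit
  have coendComul_unit : X.coendComul.lTensor X.carrier ∘ₗ X.coendUnit.lin =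
      (TensorProduct.assoc R X.carrier X.Coend X.Coend).toLinearMap ∘ₗ
        X.coendUnit.lin.rTensor X.Coend ∘ₗ X.coendUnit.lin := X.cohomDesc_unit _
  refine ⟨{ e with
    counit_comp := X.coend_hom_ext _ _ ?_, map_comp_comul := X.coend_hom_ext _ _ ?_ }⟩
  · change (Coalgebra.counit ∘ₗ e.toLinearMap).lTensor X.carrier ∘ₗ X.coendUnit.lin =
      X.coendCounit.lTensor X.carrier ∘ₗ X.coendUnit.lin
    rw [LinearMap.lTensor_comp, LinearMap.comp_assoc, he, counit_lin]
    exact (X.cohomDesc_unit (insert X (1 : R))).symm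
  · change (TensorProduct.map e.toLinearMap e.toLinearMap ∘ₗ X.coendComul).lTensor X.carrier ∘ₗ
        X.coendUnit.lin =
      (Coalgebra.comul ∘ₗ e.toLinearMap).lTensor X.carrier ∘ₗ X.coendUnit.lin
    rw [LinearMap.lTensor_comp, LinearMap.lTensor_comp, LinearMap.comp_assoc, coendComul_unit,
      LinearMap.comp_assoc, he, coassoc_lin, ← he]
    exact congrArg (· ∘ₗ X.coendUnit.lin)
      (map_lTensor_comp_assoc e.toLinearMap X.coendUnit.lin)

end Coend

section Lift

variable {R : Type u} [CommRing R] {C : Type u} [AddCommGroup C] [Module R C] [Coalgebra R C]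
  [Module.Flat R C] {K M N T : LeftComod R C}

/-- A linear map whose composite with an injective colinear map is colinear, as a colinear map.
Flatness of `C` keeps `C ⊗ i` injective, so that colinearity may be tested after `i`. -/
def homOfComp (i : K ⟶ N) (hi : Function.Injective i.lin) (f : M ⟶ N)
    (l : M.carrier →ₗ[R] K.carrier) (h : i.lin ∘ₗ l = f.lin) : M ⟶ K where
  lin := l
  colinear := by
    have lTensor_injective : Function.Injective (i.lin.lTensor C) :=
      Module.Flat.lTensor_preserves_injective_linearMap i.lin hi
    rw [← LinearMap.cancel_left lTensor_injective, ← LinearMap.comp_assoc, ← i.colinear,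
      LinearMap.comp_assoc, h, ← LinearMap.comp_assoc, ← LinearMap.lTensor_comp, h, f.colinear]

/-- The factorization of `f` through an injective colinear map `i` whose range contains that of
`f`. -/
noncomputable def lift (i : K ⟶ N) (hi : Function.Injective i.lin) (f : M ⟶ N)
    (h : LinearMap.range f.lin ≤ LinearMap.range i.lin) : M ⟶ K :=
  homOfComp i hi f
    ((LinearEquiv.ofInjective i.lin hi).symm.toLinearMap ∘ₗ
      f.lin.codRestrict (LinearMap.range i.lin) fun x => h ⟨x, rfl⟩)
    (LinearMap.ext fun _ => LinearEquiv.ofInjective_symm_apply i.lin (h := hi) _)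

theorem lift_comp (i : K ⟶ N) (hi : Function.Injective i.lin) (f : M ⟶ N)
    (h : LinearMap.range f.lin ≤ LinearMap.range i.lin) : lift i hi f h ≫ i = f :=
  hom_ext <| LinearMap.ext fun _ => LinearEquiv.ofInjective_symm_apply i.lin (h := hi) _

/-- Two comodules embedded in a third with the same range are isomorphic. -/
noncomputable def isoOfRangeEq (f : M ⟶ T) (g : N ⟶ T) (hf : Function.Injective f.lin)
    (hg : Function.Injective g.lin) (h : LinearMap.range f.lin = LinearMap.range g.lin) :
    M ≅ N where
  hom := lift g hg f h.le
  inv := lift f hf g h.ge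
  hom_inv_id := by
    have := mono_of_injective hf
    rw [← cancel_mono f, Category.assoc, lift_comp, lift_comp, Category.id_comp]
  inv_hom_id := by
    have := mono_of_injective hg
    rw [← cancel_mono g, Category.assoc, lift_comp, lift_comp, Category.id_comp]

theorem isoOfRangeEq_hom_comp (f : M ⟶ T) (g : N ⟶ T) (hf : Function.Injective f.lin)
    (hg : Function.Injective g.lin) (h : LinearMap.range f.lin = LinearMap.range g.lin) :
    (isoOfRangeEq f g hf hg h).hom ≫ g = f :=
  lift_comp g hg f h.le

end Lift

end LeftComod

namespace Bicomod

open LeftComod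

variable {R : Type u} [CommRing R] {C D : Type u} [AddCommGroup C] [Module R C] [Coalgebra R C]
  [AddCommGroup D] [Module R D] [Coalgebra R D] (X : Bicomod R C D)

/-- The right coaction of a bicomodule as a left colinear map. -/
def coactRight : X.left ⟶ tensor X.left D where
  lin := X.right.coact
  colinear := LinearMap.ext fun x => (congrArg (TensorProduct.assoc R C X.right.carrier D)
    (LinearMap.congr_fun X.colinear x)).symm.trans (LinearEquiv.apply_symm_apply _ _)

/-- The right coaction of a bicomodule tensored with `W`, as a left colinear map into
`X ⊗ (D ⊗ W)`. -/
def coactRightTensor (W : Type u) [AddCommGroup W] [Module R W] :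
    tensor X.left W ⟶ tensor X.left (D ⊗[R] W) :=
  tensorMapLeft X.coactRight W ≫ tensorAssoc X.left D W

/-- The map whose kernel is the cotensor product `X □ N`, as a left colinear map. -/
def cotensorDiffHom (N : LeftComod R D) :
    tensor X.left N.carrier ⟶ tensor X.left (D ⊗[R] N.carrier) where
  lin := cotensorDiff X.right N
  colinear := by
    have coact_sub := (LinearMap.comp_sub _ _ _).trans (congrArg₂ (· - ·)
      (X.coactRightTensor N.carrier).colinear (tensorMapRight X.left N.coact).colinear)
    rw [← LinearMap.sub_comp, ← LinearMap.lTensor_sub] at coact_sub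
    exact coact_sub

variable [Module.Flat R C]

/-- The cotensor product `X □ N` with the left comodule structure inherited from `X`. -/
noncomputable def cotensorLeft (N : LeftComod R D) : LeftComod R C :=
  ker (X.cotensorDiffHom N)

/-- The inclusion of `X □ N` in `X ⊗ N`. -/
noncomputable def cotensorLeftι (N : LeftComod R D) :
    X.cotensorLeft N ⟶ tensor X.left N.carrier :=
  kerι _

theorem cotensorLeftι_injective (N : LeftComod R D) :
    Function.Injective (X.cotensorLeftι N).lin :=
  Submodule.subtype_injective _

/-- The map `X □ g`. -/
noncomputable def cotensorLeftMap {M N : LeftComod R D} (g : M ⟶ N) :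
    X.cotensorLeft M ⟶ X.cotensorLeft N :=
  homOfComp (X.cotensorLeftι N) (X.cotensorLeftι_injective N)
    (X.cotensorLeftι M ≫ tensorMapRight X.left g.lin) (cotensorMap (𝟙 X.right) g) rfl

theorem cotensorLeftMap_comp_ι {M N : LeftComod R D} (g : M ⟶ N) :
    X.cotensorLeftMap g ≫ X.cotensorLeftι N =
      X.cotensorLeftι M ≫ tensorMapRight X.left g.lin := rfl

/-- The functor `X □ -` from left `D`-comodules to left `C`-comodules. -/
noncomputable def cotensorLeftFunctor : LeftComod R D ⥤ LeftComod R C where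
  obj N := X.cotensorLeft N
  map g := X.cotensorLeftMap g
  map_id N := hom_ext (cotensorMap_id X.right N)
  map_comp f g := hom_ext (cotensorMap_comp (𝟙 X.right) (𝟙 X.right) f g)

end Bicomod

theorem bijective_comp_map_comp {𝒜 ℬ : Type*} [Category 𝒜] [Category ℬ] (F : 𝒜 ⥤ ℬ) [F.Full]
    [F.Faithful] {A B : 𝒜} {X Y : ℬ} (i : X ≅ F.obj A) (j : F.obj B ≅ Y) :
    Function.Bijective fun f : A ⟶ B => i.hom ≫ F.map f ≫ j.hom :=
  (j.homToEquiv.trans i.symm.homFromEquiv).bijective.comp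
    ((Functor.FullyFaithful.ofFullyFaithful F).map_bijective A B)

namespace RightComod

section Image

variable {R : Type u} [CommRing R] {C D : Type u} [AddCommGroup C] [Module R C] [Coalgebra R C]
  [AddCommGroup D] [Module R D] [Coalgebra R D]

theorem coactHom_universal (M : RightComod R C) (W : Type u) [AddCommGroup W] [Module R W] :
    Function.Bijective fun g : M.carrier →ₗ[R] W =>
      coactHom M ≫ tensorMapLeft g (regular R C) :=
  (ModuleCat.homEquiv.symm.trans
    ((forgetfulAdj R C).homEquiv M (ModuleCat.of R W))).bijective

variable (E : RightComod R C ≌ RightComod R D) [E.functor.Additive] [E.functor.Linear R]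

/-- The functors `- ⊗ F(M)` and `F(- ⊗ M)` agree for a linear equivalence `F`. -/
noncomputable def tensorFunctorIso (M : RightComod R C) :
    (E.functor.obj M).tensorFunctor ≅ M.tensorFunctor ⋙ E.functor :=
  NatIso.ofComponents (fun W =>
      @asIso _ _ _ _ (comparison E.functor W M) (comparison_isIso E W M))
    fun g => comparison_natural_left E.functor g.hom M

/-- The functor `- ⊗ F(C)` is right adjoint to the inverse of `F` followed by the forgetful
functor. -/
noncomputable def imageAdj : E.inverse ⋙ forgetful R C ⊣
    (E.functor.obj (regular R C)).tensorFunctor :=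
  (E.symm.toAdjunction.comp (forgetfulAdj R C)).ofNatIsoRight (tensorFunctorIso E _).symm

theorem image_quasiFinite : (E.functor.obj (regular R C)).QuasiFinite :=
  (imageAdj E).isRightAdjoint

theorem image_injector [Module.Flat R C] : (E.functor.obj (regular R C)).Injector :=
  fun W _ => Injective.injective_of_adjoint (imageAdj E) W

theorem imageCoact_comp_tensorMapLeft {W : Type u} [AddCommGroup W] [Module R W]
    (g : C →ₗ[R] W) :
    imageCoact E ≫ tensorMapLeft g (E.functor.obj (regular R C)) =
      E.functor.map (coactHom (regular R C) ≫ tensorMapLeft g (regular R C)) ≫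
        inv (comparison E.functor W (regular R C)) := by
  rw [IsIso.eq_comp_inv, Category.assoc, comparison_natural_left, ← Category.assoc,
    imageCoact_comparison, ← E.functor.map_comp]
  rfl

theorem imageCoact_universal (W : Type u) [AddCommGroup W] [Module R W] :
    Function.Bijective fun g : C →ₗ[R] W =>
      imageCoact E ≫ tensorMapLeft g (E.functor.obj (regular R C)) := by
  have bijective := (bijective_comp_map_comp E.functor (Iso.refl (E.functor.obj (regular R C)))
    (asIso (comparison E.functor W (regular R C))).symm).comp (coactHom_universal _ W)
  simp only [Function.comp_def, Iso.refl_hom, Iso.symm_hom, asIso_inv, Category.id_comp]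
    at bijective
  simp only [imageCoact_comp_tensorMapLeft]
  exact bijective

theorem nonempty_coend_image_coalgEquiv [(E.functor.obj (regular R C)).QuasiFinite] :
    Nonempty ((E.functor.obj (regular R C)).Coend ≃ₗc[R] C) :=
  nonempty_coend_coalgEquiv_of_universal _ (imageCoact E) (imageCoact_universal E)
    (imageCoact_coassoc E) (imageCoact_counit E)

end Image

end RightComod

/-! ### The image of an equivalence as a cotensor product -/

theorem exact_map_of_natIso {𝒜 R : Type*} [Category 𝒜] [Ring R] {U V : 𝒜 ⥤ ModuleCat R}
    (α : U ≅ V) {X Y Z : 𝒜} {f : X ⟶ Y} {g : Y ⟶ Z}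
    (h : Function.Exact (U.map f).hom (U.map g).hom) :
    Function.Exact (V.map f).hom (V.map g).hom :=
  Function.Exact.of_ladder_linearEquiv_of_exact (e₁ := (α.app X).toLinearEquiv)
    (e₂ := (α.app Y).toLinearEquiv) (e₃ := (α.app Z).toLinearEquiv)
    (congrArg ModuleCat.Hom.hom (α.hom.naturality f).symm)
    (congrArg ModuleCat.Hom.hom (α.hom.naturality g).symm) h

namespace RightComod

section CotensorDiff

variable {R : Type u} [CommRing R] {C : Type u} [AddCommGroup C] [Module R C] [Coalgebra R C]

theorem tensorMapRight_comp (W : Type u) [AddCommGroup W] [Module R W] {L M N : RightComod R C}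
    (f : L ⟶ M) (g : M ⟶ N) :
    tensorMapRight W (f ≫ g) = tensorMapRight W f ≫ tensorMapRight W g :=
  hom_ext (LinearMap.lTensor_comp W g.lin f.lin)

/-- The difference of the two colinear maps `M ⊗ C ⟶ M ⊗ C ⊗ C` given by the coaction of `M` and
the comultiplication of `C`; its kernel is `M`. -/
noncomputable def cobarDiff (M : RightComod R C) :
    tensor M.carrier (regular R C) ⟶ tensor (M.carrier ⊗[R] C) (regular R C) :=
  tensorMapLeft M.coact (regular R C) -
    tensorMapRight M.carrier (regularComul R C) ≫ tensorAssocInv M.carrier C (regular R C)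

theorem exact_coactHom_cobarDiff (M : RightComod R C) :
    Function.Exact (coactHom M).lin (cobarDiff M).lin := by
  rw [cobarDiff, sub_lin]
  exact M.linearSplitEqualizer_coact.exact_sub

theorem cotensorDiff_tensor (W : Type u) [AddCommGroup W] [Module R W] (M : RightComod R C)
    (N : LeftComod R C) :
    cotensorDiff (tensor W M) N ∘ₗ
        (TensorProduct.assoc R W M.carrier N.carrier).symm.toLinearMap =
      (TensorProduct.assoc R W M.carrier (C ⊗[R] N.carrier)).symm.toLinearMap ∘ₗ
        (cotensorDiff M N).lTensor W := by
  ext w m n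
  simp only [cotensorDiff, LinearMap.lTensor_sub, TensorProduct.AlgebraTensorModule.curry_apply,
    TensorProduct.curry_apply, LinearMap.coe_restrictScalars, LinearMap.sub_apply,
    LinearMap.comp_apply, LinearEquiv.coe_coe, LinearMap.lTensor_tmul, LinearMap.rTensor_tmul,
    TensorProduct.assoc_symm_tmul, map_sub]
  refine congrArg₂ (· - ·) ?_ rfl
  change TensorProduct.assoc R _ C _ (Coact.right W M.coact (w ⊗ₜ m) ⊗ₜ n) = _
  rw [Coact.right_tmul]
  induction M.coact m with
  | zero => simp
  | add y z hy hz => simp only [TensorProduct.tmul_add, TensorProduct.add_tmul, map_add, hy, hz]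
  | tmul m' c => rfl

end CotensorDiff

section ImageEmbedding

variable {R : Type u} [CommRing R] {C D : Type u} [AddCommGroup C] [Module R C] [Coalgebra R C]
  [AddCommGroup D] [Module R D] [Coalgebra R D]
  (E : RightComod R C ≌ RightComod R D) [E.functor.Additive] [E.functor.Linear R]

/-- The canonical isomorphism `W ⊗ F(M) ≃ F(W ⊗ M)` of `R`-modules. -/
noncomputable def comparisonEquiv (W : Type u) [AddCommGroup W] [Module R W]
    (M : RightComod R C) :
    W ⊗[R] (E.functor.obj M).carrier ≃ₗ[R] (E.functor.obj (tensor W M)).carrier :=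
  ((forgetful R D).mapIso (asIso (comparison E.functor W M))).toLinearEquiv

/-- The natural map `F(M) ⟶ M ⊗ F(C)` that identifies `F(M)` with the cotensor product of `M` and
`F(C)`. -/
noncomputable def imageEmbedding (M : RightComod R C) :
    E.functor.obj M ⟶ tensor M.carrier (E.functor.obj (regular R C)) :=
  E.functor.map (coactHom M) ≫ inv (comparison E.functor M.carrier (regular R C))

theorem imageEmbedding_comparison (M : RightComod R C) :
    imageEmbedding E M ≫ comparison E.functor M.carrier (regular R C) =
      E.functor.map (coactHom M) := by
  rw [imageEmbedding, Category.assoc, IsIso.inv_hom_id, Category.comp_id]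

theorem imageEmbedding_naturality {M N : RightComod R C} (f : M ⟶ N) :
    E.functor.map f ≫ imageEmbedding E N =
      imageEmbedding E M ≫ tensorMapLeft f.lin (E.functor.obj (regular R C)) := by
  rw [← cancel_mono (comparison E.functor N.carrier (regular R C)), Category.assoc,
    Category.assoc, imageEmbedding_comparison, comparison_natural_left, ← Category.assoc,
    imageEmbedding_comparison, ← E.functor.map_comp, ← E.functor.map_comp, coactHom_naturality]

theorem imageEmbedding_tensor (W : Type u) [AddCommGroup W] [Module R W] (M : RightComod R C) :
    comparison E.functor W M ≫ imageEmbedding E (tensor W M) =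
      tensorMapRight W (imageEmbedding E M) ≫
        tensorAssocInv W M.carrier (E.functor.obj (regular R C)) := by
  have coactHom_tensor : coactHom (tensor W M) =
      tensorMapRight W (coactHom M) ≫ tensorAssocInv W M.carrier (regular R C) := rfl
  rw [← cancel_mono (comparison E.functor (W ⊗[R] M.carrier) (regular R C)), Category.assoc,
    Category.assoc, imageEmbedding_comparison, comparison_assoc, ← Category.assoc
    (tensorMapRight W _), ← tensorMapRight_comp, imageEmbedding_comparison, ← Category.assoc
    (tensorMapRight W _), comparison_natural_right, Category.assoc, coactHom_tensor,
    E.functor.map_comp]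

theorem comparison_comp_map_cobarDiff (M : RightComod R C) :
    comparison E.functor M.carrier (regular R C) ≫ E.functor.map (cobarDiff M) =
      (tensorMapLeft M.coact (E.functor.obj (regular R C)) -
        tensorMapRight M.carrier (imageCoact E) ≫
          tensorAssocInv M.carrier C (E.functor.obj (regular R C))) ≫
        comparison E.functor (M.carrier ⊗[R] C) (regular R C) := by
  rw [cobarDiff, E.functor.map_sub, Preadditive.comp_sub, Preadditive.sub_comp,
    comparison_natural_left, Category.assoc, comparison_assoc, ← Category.assoc
    (tensorMapRight M.carrier (imageCoact E)), ← tensorMapRight_comp, imageCoact_comparison,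
    ← Category.assoc, comparison_natural_right, E.functor.map_comp, Category.assoc]

theorem map_cobarDiff_comp_comparisonEquiv (M : RightComod R C) :
    (E.functor.map (cobarDiff M)).lin ∘ₗ
        (comparisonEquiv E M.carrier (regular R C)).toLinearMap =
      ((TensorProduct.assoc R M.carrier C (E.functor.obj (regular R C)).carrier).symm ≪≫ₗ
        comparisonEquiv E (M.carrier ⊗[R] C) (regular R C)).toLinearMap ∘ₗ
        cotensorDiff M (imageBicomod E).left := by
  have cobarDiff_image : (tensorMapLeft M.coact (E.functor.obj (regular R C)) -
      tensorMapRight M.carrier (imageCoact E) ≫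
        tensorAssocInv M.carrier C (E.functor.obj (regular R C))).lin =
      (TensorProduct.assoc R M.carrier C _).symm.toLinearMap ∘ₗ
        cotensorDiff M (imageBicomod E).left := by
    rw [sub_lin, cotensorDiff, LinearMap.comp_sub, ← LinearMap.comp_assoc, LinearEquiv.symm_comp,
      LinearMap.id_comp]
    rfl
  refine (congrArg Hom.lin (comparison_comp_map_cobarDiff E M)).trans ?_
  rw [comp_lin, cobarDiff_image]
  rfl

variable [Module.Flat R D]

theorem imageEmbedding_injective (M : RightComod R C) :
    Function.Injective (imageEmbedding E M).lin := by
  have : Mono (coactHom M) := mono_of_injective M.linearSplitEqualizer_coact.injective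
  exact injective_of_mono (E.functor.map (coactHom M) ≫ inv _)

theorem exact_imageEmbedding_cotensorDiff (M : RightComod R C) :
    Function.Exact (imageEmbedding E M).lin (cotensorDiff M (imageBicomod E).left) :=
  (Function.Exact.iff_of_ladder_linearEquiv (e₁ := LinearEquiv.refl R _)
    (e₂ := comparisonEquiv E M.carrier (regular R C))
    (congrArg Hom.lin (imageEmbedding_comparison E M)).symm
    (map_cobarDiff_comp_comparisonEquiv E M)).1 <|
  exact_map_of_isEquivalence (forgetful R C) (forgetful R D) E.functor (exact_coactHom_cobarDiff M)

theorem lTensor_imageEmbedding_injective (W : Type u) [AddCommGroup W] [Module R W]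
    (M : RightComod R C) : Function.Injective ((imageEmbedding E M).lin.lTensor W) := by
  refine Function.Injective.of_comp (f := (TensorProduct.assoc R W M.carrier _).symm) ?_
  have injective := (imageEmbedding_injective E (tensor W M)).comp
    (comparisonEquiv E W M).injective
  exact (congrArg (fun f => Function.Injective f.lin) (imageEmbedding_tensor E W M)).mp injective

theorem exact_lTensor_imageEmbedding_cotensorDiff (W : Type u) [AddCommGroup W] [Module R W]
    (M : RightComod R C) : Function.Exact ((imageEmbedding E M).lin.lTensor W)
      ((cotensorDiff M (imageBicomod E).left).lTensor W) :=
  (Function.Exact.iff_of_ladder_linearEquiv (e₁ := comparisonEquiv E W M)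
    (congrArg Hom.lin (imageEmbedding_tensor E W M))
    (cotensorDiff_tensor W M (imageBicomod E).left)).1 <|
  exact_imageEmbedding_cotensorDiff E (tensor W M)

/-- The isomorphism of `F(M)` with the cotensor product of `M` and `F(C)`. -/
noncomputable def imageCotensorIso :
    E.functor ⋙ forgetful R D ≅ (imageBicomod E).left.cotensorFunctor :=
  NatIso.ofComponents
    (fun M => (LinearEquiv.ofInjective _ (imageEmbedding_injective E M) ≪≫ₗ
      LinearEquiv.ofEq _ _
        (exact_imageEmbedding_cotensorDiff E M).linearMap_ker_eq.symm).toModuleIso)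
    fun f => ModuleCat.hom_ext <| LinearMap.ext fun x => Subtype.ext <|
      LinearMap.congr_fun (congrArg Hom.lin (imageEmbedding_naturality E f)) x

theorem image_left_faithfullyCoflat : (imageBicomod E).left.FaithfullyCoflat :=
  ⟨fun _ _ _ _ _ h => exact_map_of_natIso (imageCotensorIso E)
      (exact_map_of_isEquivalence (forgetful R C) (forgetful R D) E.functor h),
    Functor.Faithful.of_iso (imageCotensorIso E)⟩

theorem image_flat [Module.Flat R C] : Module.Flat R (E.functor.obj (regular R C)).carrier := by
  rw [Module.Flat.iff_rTensor_preserves_injective_linearMap]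
  intro V W _ _ _ _ g hg
  have : Mono (tensorMapLeft g (regular R C)) :=
    mono_of_injective (Module.Flat.rTensor_preserves_injective_linearMap (M := C) g hg)
  have : Mono (tensorMapLeft g (E.functor.obj (regular R C)) ≫
      comparison E.functor W (regular R C)) := by
    rw [comparison_natural_left]
    infer_instance
  have : Mono (tensorMapLeft g (E.functor.obj (regular R C))) :=
    mono_of_mono _ (comparison E.functor W (regular R C))
  exact injective_of_mono (tensorMapLeft g (E.functor.obj (regular R C)))

end ImageEmbedding

end RightComod

/-! ### Mutually inverse cotensor functors -/

theorem range_comp_eq_ker_inf_ker {R A B P Q S T : Type*} [Ring R] [AddCommGroup A] [Module R A]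
    [AddCommGroup B] [Module R B] [AddCommGroup P] [Module R P] [AddCommGroup Q] [Module R Q]
    [AddCommGroup S] [Module R S] [AddCommGroup T] [Module R T] {i : A →ₗ[R] B} {f : B →ₗ[R] S}
    {j : B →ₗ[R] P} {p : P →ₗ[R] Q} {q : P →ₗ[R] T} {k : S →ₗ[R] T} (exact_i : Function.Exact i f)
    (exact_j : Function.Exact j p) (hk : Function.Injective k) (square : q ∘ₗ j = k ∘ₗ f) :
    LinearMap.range (j ∘ₗ i) = LinearMap.ker p ⊓ LinearMap.ker q := by
  rw [LinearMap.range_comp, ← exact_i.linearMap_ker_eq,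
    ← LinearMap.ker_comp_of_ker_eq_bot f (LinearMap.ker_eq_bot.2 hk), ← square,
    LinearMap.ker_comp, Submodule.map_comap_eq, ← exact_j.linearMap_ker_eq]

theorem assoc_comp_rTensor_comp_lTensor {R D X Y M N : Type*} [CommRing R] [AddCommGroup D]
    [Module R D] [AddCommGroup X] [Module R X] [AddCommGroup Y] [Module R Y] [AddCommGroup M]
    [Module R M] [AddCommGroup N] [Module R N] (b : D →ₗ[R] Y ⊗[R] X) (g : M →ₗ[R] N) :
    (TensorProduct.assoc R Y X N).toLinearMap ∘ₗ b.rTensor N ∘ₗ g.lTensor D =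
      (g.lTensor X).lTensor Y ∘ₗ (TensorProduct.assoc R Y X M).toLinearMap ∘ₗ b.rTensor M := by
  rw [LinearMap.rTensor_comp_lTensor, ← LinearMap.lTensor_comp_rTensor, LinearMap.lTensor_tensor]
  ext
  simp

theorem LeftComod.cotensorDiff_tensor {R : Type u} [CommRing R] {C : Type u} [AddCommGroup C]
    [Module R C] [Coalgebra R C] (M : RightComod R C) (N : LeftComod R C) (W : Type u)
    [AddCommGroup W] [Module R W] :
    cotensorDiff M (tensor N W) ∘ₗ (TensorProduct.assoc R M.carrier N.carrier W).toLinearMap =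
      (TensorProduct.assoc R M.carrier (C ⊗[R] N.carrier) W ≪≫ₗ
        (TensorProduct.assoc R C N.carrier W).lTensor M.carrier).toLinearMap ∘ₗ
        (cotensorDiff M N).rTensor W := by
  refine TensorProduct.ext_threefold fun m n w => ?_
  simp only [cotensorDiff, LinearMap.rTensor_sub, LinearMap.comp_sub, LinearMap.sub_comp,
    LinearMap.sub_apply, LinearMap.comp_apply, LinearEquiv.coe_coe, LinearEquiv.trans_apply,
    LinearMap.rTensor_tmul, TensorProduct.assoc_tmul]
  refine congrArg₂ (· - ·) ?_ rfl
  induction M.coact m with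
  | zero => simp
  | add y z hy hz => simp only [TensorProduct.add_tmul, map_add, hy, hz]
  | tmul m' c => rfl

section CotensorEquivalence

variable {R : Type u} [CommRing R] {C D : Type u} [AddCommGroup C] [Module R C] [Coalgebra R C]
  [AddCommGroup D] [Module R D] [Coalgebra R D]

/-- The map `b : D ⟶ Y ⊗ X` is a map of `D`-bicomodules that identifies `D` with the cotensor
product of `Y` and `X`, and still does so after tensoring with any `R`-module. This purity is what
makes `Y □ (X □ N) ≅ (Y □ X) □ N ≅ N` hold for comodules `N` that are not flat. -/
structure IsPureCotensor (X : Bicomod R C D) (Y : Bicomod R D C)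
    (b : RightComod.regular R D ⟶ RightComod.tensor Y.right.carrier X.right) : Prop where
  rTensor_injective (W : Type u) [AddCommGroup W] [Module R W] :
    Function.Injective (b.lin.rTensor W)
  exact_rTensor (W : Type u) [AddCommGroup W] [Module R W] :
    Function.Exact (b.lin.rTensor W) ((cotensorDiff Y.right X.left).rTensor W)
  left_colinear : Coact.left Y.coactLeft X.right.carrier ∘ₗ b.lin =
    b.lin.lTensor D ∘ₗ Coalgebra.comul

open LeftComod

variable {X : Bicomod R C D} {Y : Bicomod R D C}
  {b : RightComod.regular R D ⟶ RightComod.tensor Y.right.carrier X.right}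

namespace IsPureCotensor

theorem exact_assoc_comp_rTensor (h : IsPureCotensor X Y b) (W : Type u) [AddCommGroup W]
    [Module R W] :
    Function.Exact
      ((TensorProduct.assoc R Y.right.carrier X.right.carrier W).toLinearMap ∘ₗ b.lin.rTensor W)
      (cotensorDiff Y.right (tensor X.left W)) :=
  Function.Exact.of_ladder_linearEquiv_of_exact (e₁ := LinearEquiv.refl R _) rfl
    (cotensorDiff_tensor Y.right X.left W) (h.exact_rTensor W)

theorem lTensor_cotensorDiff_comp_assoc_comp_rTensor (N : LeftComod R D) :
    (cotensorDiff X.right N).lTensor Y.right.carrier ∘ₗ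
        (TensorProduct.assoc R Y.right.carrier X.right.carrier N.carrier).toLinearMap ∘ₗ
          b.lin.rTensor N.carrier =
      ((TensorProduct.assoc R Y.right.carrier X.right.carrier (D ⊗[R] N.carrier)).toLinearMap ∘ₗ
        b.lin.rTensor (D ⊗[R] N.carrier)) ∘ₗ cotensorDiff (RightComod.regular R D) N := by
  refine LinearMap.ext fun z => (LinearEquiv.symm_apply_eq
    (TensorProduct.assoc R Y.right.carrier X.right.carrier (D ⊗[R] N.carrier))).1 ?_
  have tensor_assoc := LinearMap.congr_fun
    (RightComod.cotensorDiff_tensor Y.right.carrier X.right N)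
    (TensorProduct.assoc R _ _ _ (b.lin.rTensor N.carrier z))
  have naturality := cotensorDiff_map b (𝟙 N) z
  rw [id_lin, LinearMap.lTensor_id] at naturality
  exact tensor_assoc.symm.trans ((congrArg _ (LinearEquiv.symm_apply_apply _ _)).trans naturality)

/-- The coaction of `N` followed by `b`, as a colinear map `N ⟶ Y ⊗ X ⊗ N`. -/
def embedding (h : IsPureCotensor X Y b) (N : LeftComod R D) :
    N ⟶ tensor Y.left (X.right.carrier ⊗[R] N.carrier) :=
  coactHom N ≫ tensorMapLeft
    (show regular R D ⟶ tensor Y.left X.right.carrier from ⟨b.lin, h.left_colinear⟩) N.carrier ≫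
      tensorAssoc Y.left X.right.carrier N.carrier

theorem embedding_injective (h : IsPureCotensor X Y b) (N : LeftComod R D) :
    Function.Injective (h.embedding N).lin :=
  (TensorProduct.assoc R Y.right.carrier X.right.carrier N.carrier).injective.comp
    ((h.rTensor_injective _).comp N.linearSplitEqualizer_coact.injective)

theorem embedding_naturality (h : IsPureCotensor X Y b) {M N : LeftComod R D} (g : M ⟶ N) :
    g ≫ h.embedding N =
      h.embedding M ≫ tensorMapRight Y.left (g.lin.lTensor X.right.carrier) := by
  refine hom_ext <| LinearMap.ext fun m => ?_
  refine Eq.trans ?_ (LinearMap.congr_fun (assoc_comp_rTensor_comp_lTensor b.lin g.lin) (M.coact m))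
  exact congrArg _ (congrArg _ (LinearMap.congr_fun g.colinear m))

theorem range_embedding (h : IsPureCotensor X Y b) (N : LeftComod R D) :
    LinearMap.range (h.embedding N).lin =
      LinearMap.ker (cotensorDiff Y.right (tensor X.left N.carrier)) ⊓
        LinearMap.ker ((cotensorDiff X.right N).lTensor Y.right.carrier) :=
  range_comp_eq_ker_inf_ker N.exact_coact_cotensorDiff (h.exact_assoc_comp_rTensor N.carrier)
    ((TensorProduct.assoc R _ _ _).injective.comp (h.rTensor_injective (D ⊗[R] N.carrier)))
    (lTensor_cotensorDiff_comp_assoc_comp_rTensor N)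

end IsPureCotensor

namespace Bicomod

variable [Module.Flat R C] [Module.Flat R D]

/-- The inclusion `Y □ (X □ N) ⟶ Y ⊗ X ⊗ N`. -/
noncomputable def doubleCotensorι (X : Bicomod R C D) (Y : Bicomod R D C) (N : LeftComod R D) :
    Y.cotensorLeft (X.cotensorLeft N) ⟶ tensor Y.left (X.right.carrier ⊗[R] N.carrier) :=
  Y.cotensorLeftι (X.cotensorLeft N) ≫ tensorMapRight Y.left (X.cotensorLeftι N).lin

theorem doubleCotensorι_naturality {M N : LeftComod R D} (g : M ⟶ N) :
    Y.cotensorLeftMap (X.cotensorLeftMap g) ≫ doubleCotensorι X Y N =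
      doubleCotensorι X Y M ≫ tensorMapRight Y.left (g.lin.lTensor _) := by
  have square : (X.cotensorLeftι N).lin.lTensor Y.right.carrier ∘ₗ
      (X.cotensorLeftMap g).lin.lTensor Y.right.carrier =
      (g.lin.lTensor X.right.carrier).lTensor Y.right.carrier ∘ₗ
        (X.cotensorLeftι M).lin.lTensor Y.right.carrier :=
    TensorProduct.ext' fun _ _ => rfl
  exact hom_ext (LinearMap.ext fun t => LinearMap.congr_fun square t.1)

variable [Module.Flat R Y.right.carrier]

theorem doubleCotensorι_injective (N : LeftComod R D) :
    Function.Injective (doubleCotensorι X Y N).lin :=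
  (Module.Flat.lTensor_preserves_injective_linearMap (M := Y.right.carrier) _
    (X.cotensorLeftι_injective N)).comp (Y.cotensorLeftι_injective _)

theorem range_doubleCotensorι (N : LeftComod R D) :
    LinearMap.range (doubleCotensorι X Y N).lin =
      LinearMap.ker (cotensorDiff Y.right (tensor X.left N.carrier)) ⊓
        LinearMap.ker ((cotensorDiff X.right N).lTensor Y.right.carrier) := by
  have lTensor_exact := Module.Flat.lTensor_exact Y.right.carrier
    (cotensorDiff X.right N).exact_subtype_ker_map
  rw [inf_comm]
  exact range_comp_eq_ker_inf_ker (cotensorDiff Y.right (X.cotensorLeft N)).exact_subtype_ker_map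
    lTensor_exact (Module.Flat.lTensor_preserves_injective_linearMap (M := Y.right.carrier) _
      (Module.Flat.lTensor_preserves_injective_linearMap (M := C) _
        (X.cotensorLeftι_injective N)))
    (LinearMap.ext (cotensorDiff_map (𝟙 Y.right) (X.cotensorLeftι N)))

end Bicomod

namespace IsPureCotensor

open Bicomod

variable [Module.Flat R C] [Module.Flat R D] [Module.Flat R Y.right.carrier]

/-- Every left `D`-comodule `N` is isomorphic to `Y □ (X □ N)`. -/
noncomputable def cotensorIsoApp (h : IsPureCotensor X Y b) (N : LeftComod R D) :
    N ≅ Y.cotensorLeft (X.cotensorLeft N) :=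
  isoOfRangeEq (h.embedding N) (doubleCotensorι X Y N) (h.embedding_injective N)
    (doubleCotensorι_injective N) ((h.range_embedding N).trans (range_doubleCotensorι N).symm)

theorem cotensorIsoApp_comp (h : IsPureCotensor X Y b) (N : LeftComod R D) :
    (h.cotensorIsoApp N).hom ≫ doubleCotensorι X Y N = h.embedding N :=
  isoOfRangeEq_hom_comp _ _ _ _ _

theorem cotensorIsoApp_naturality (h : IsPureCotensor X Y b) {M N : LeftComod R D} (g : M ⟶ N) :
    g ≫ (h.cotensorIsoApp N).hom =
      (h.cotensorIsoApp M).hom ≫ Y.cotensorLeftMap (X.cotensorLeftMap g) := by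
  have := mono_of_injective (doubleCotensorι_injective (X := X) (Y := Y) N)
  rw [← cancel_mono (doubleCotensorι X Y N), Category.assoc, cotensorIsoApp_comp,
    embedding_naturality, ← cotensorIsoApp_comp, Category.assoc, Category.assoc]
  exact congrArg ((h.cotensorIsoApp M).hom ≫ ·) (doubleCotensorι_naturality g).symm

/-- The functors `X □ -` and `Y □ -` compose to the identity. -/
noncomputable def cotensorIso (h : IsPureCotensor X Y b) :
    𝟭 (LeftComod R D) ≅ X.cotensorLeftFunctor ⋙ Y.cotensorLeftFunctor :=
  NatIso.ofComponents h.cotensorIsoApp h.cotensorIsoApp_naturality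

/-- The equivalence `X □ -` of categories of left comodules, with inverse `Y □ -`. -/
noncomputable def equivalence [Module.Flat R X.right.carrier] (h : IsPureCotensor X Y b)
    {a : RightComod.regular R C ⟶ RightComod.tensor X.right.carrier Y.right}
    (h' : IsPureCotensor Y X a) : LeftComod R D ≌ LeftComod R C :=
  CategoryTheory.Equivalence.mk X.cotensorLeftFunctor Y.cotensorLeftFunctor h.cotensorIso
    h'.cotensorIso.symm

end IsPureCotensor

end CotensorEquivalence

namespace RightComod

section ImageBicomodule

variable {R : Type u} [CommRing R] {C D : Type u} [AddCommGroup C] [Module R C] [Coalgebra R C]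
  [AddCommGroup D] [Module R D] [Coalgebra R D]
  (E : RightComod R C ≌ RightComod R D) [E.functor.Additive] [E.functor.Linear R]

/-- The canonical map `D ≅ F(G(D)) ⟶ G(D) ⊗ F(C)`, which identifies `D` with the cotensor product
of `G(D)` and `F(C)`. -/
noncomputable def coevaluation : regular R D ⟶
    tensor (E.inverse.obj (regular R D)).carrier (E.functor.obj (regular R C)) :=
  E.counitInv.app (regular R D) ≫ imageEmbedding E (E.inverse.obj (regular R D))

theorem counitInv_tensor (W : Type u) [AddCommGroup W] [Module R W] (N : RightComod R D) :
    tensorMapRight W (E.counitInv.app N) ≫ comparison E.functor W (E.inverse.obj N) ≫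
      E.functor.map (comparison E.symm.functor W N) = E.counitInv.app (tensor W N) := by
  refine tensor_hom_ext fun w => ?_
  calc insert w N ≫ tensorMapRight W (E.counitInv.app N) ≫ comparison E.functor W _ ≫
        E.functor.map (comparison E.symm.functor W N)
    _ = E.counitInv.app N ≫ (insert w (E.functor.obj (E.inverse.obj N)) ≫
          comparison E.functor W _) ≫ E.functor.map (comparison E.symm.functor W N) := by
      rw [← Category.assoc, insert_tensorMapRight, Category.assoc, Category.assoc]
      rfl
    _ = E.counitInv.app N ≫ E.functor.map (E.inverse.map (insert w N)) := by
      rw [insert_comparison, ← E.functor.map_comp]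
      exact congrArg (fun f => E.counitInv.app N ≫ E.functor.map f)
        (insert_comparison E.symm.functor w N)
    _ = insert w N ≫ E.counitInv.app (tensor W N) := (E.counitInv.naturality (insert w N)).symm

theorem counitInv_comp_map_imageCoact :
    E.counitInv.app (regular R D) ≫ E.functor.map (imageCoact E.symm) =
      regularComul R D ≫ tensorMapRight D (E.counitInv.app (regular R D)) ≫
        comparison E.functor D (E.inverse.obj (regular R D)) := by
  have : IsIso (comparison E.symm.functor D (regular R D)) := comparison_isIso E.symm _ _
  rw [← cancel_mono (E.functor.map (comparison E.symm.functor D (regular R D)))]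
  simp only [Category.assoc]
  rw [counitInv_tensor, ← E.functor.map_comp, imageCoact_comparison]
  exact (E.counitInv.naturality (regularComul R D)).symm

theorem coevaluation_comp_tensorMapLeft_imageCoact :
    coevaluation E ≫ tensorMapLeft (imageCoact E.symm).lin (E.functor.obj (regular R C)) =
      regularComul R D ≫ tensorMapRight D (coevaluation E) ≫ tensorAssocInv D _ _ := by
  calc coevaluation E ≫ tensorMapLeft (imageCoact E.symm).lin (E.functor.obj (regular R C))
    _ = E.counitInv.app _ ≫ E.functor.map (imageCoact E.symm) ≫ imageEmbedding E _ := by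
      rw [coevaluation, Category.assoc]
      exact congrArg (_ ≫ ·) (imageEmbedding_naturality E (imageCoact E.symm)).symm
    _ = (regularComul R D ≫ tensorMapRight D (E.counitInv.app _) ≫ comparison E.functor D _) ≫
          imageEmbedding E (tensor D (E.inverse.obj (regular R D))) :=
      (Category.assoc _ _ _).symm.trans
        (congrArg (· ≫ imageEmbedding E _) (counitInv_comp_map_imageCoact E))
    _ = regularComul R D ≫ tensorMapRight D (coevaluation E) ≫ tensorAssocInv D _ _ := by
      rw [coevaluation, tensorMapRight_comp, Category.assoc, ← imageEmbedding_tensor]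
      rfl

/-- The isomorphism of `D` with `F(G(D))`. -/
noncomputable def counitEquiv :
    D ≃ₗ[R] (E.functor.obj (E.inverse.obj (regular R D))).carrier :=
  ((forgetful R D).mapIso (E.counitIso.symm.app (regular R D))).toLinearEquiv

theorem lTensor_coevaluation (W : Type u) [AddCommGroup W] [Module R W] :
    (coevaluation E).lin.lTensor W =
      (imageEmbedding E (E.inverse.obj (regular R D))).lin.lTensor W ∘ₗ
        ((counitEquiv E).lTensor W).toLinearMap :=
  LinearMap.lTensor_comp W _ _

theorem isPureCotensor_imageBicomod [Module.Flat R D] :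
    IsPureCotensor (imageBicomod E) (imageBicomod E.symm) (coevaluation E) where
  rTensor_injective W _ _ := by
    refine (LinearMap.lTensor_inj_iff_rTensor_inj W (coevaluation E).lin).1 ?_
    rw [lTensor_coevaluation]
    exact (lTensor_imageEmbedding_injective E W _).comp ((counitEquiv E).lTensor W).injective
  exact_rTensor W _ _ := by
    have exact_lTensor := LinearEquiv.precomp_exact_iff_exact (e := (counitEquiv E).lTensor W).2
      (exact_lTensor_imageEmbedding_cotensorDiff E W (E.inverse.obj (regular R D)))
    rw [← lTensor_coevaluation] at exact_lTensor
    exact (LinearMap.rTensor_exact_iff_lTensor_exact W).2 exact_lTensor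
  left_colinear := LinearMap.ext fun x => (congrArg (TensorProduct.assoc R D _ _)
    (LinearMap.congr_fun (congrArg Hom.lin (coevaluation_comp_tensorMapLeft_imageCoact E)) x)).trans
      (LinearEquiv.apply_symm_apply _ _)

end ImageBicomodule

end RightComod

/-! ### Left comodule properties of bicomodules -/

namespace RightComod

variable {R : Type u} [CommRing R] {C : Type u} [AddCommGroup C] [Module R C] [Coalgebra R C]

theorem linearSplitEqualizer_cotensor (M : RightComod R C) :
    LinearSplitEqualizer M.coact
      ((TensorProduct.assoc R M.carrier C C).toLinearMap ∘ₗ M.coact.rTensor C)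
      ((Coalgebra.comul (R := R) (A := C)).lTensor M.carrier) := by
  have h := M.linearSplitEqualizer_coact.comp_linearEquiv (TensorProduct.assoc R M.carrier C C)
  rwa [← LinearMap.comp_assoc _ _ (TensorProduct.assoc R M.carrier C C).toLinearMap,
    LinearEquiv.comp_symm, LinearMap.id_comp] at h

theorem exact_coact_cotensorDiff (M : RightComod R C) :
    Function.Exact M.coact (cotensorDiff M (LeftComod.regular R C)) :=
  M.linearSplitEqualizer_cotensor.exact_sub

theorem exact_assoc_comp_rTensor_coact (M : RightComod R C) (W : Type u) [AddCommGroup W]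
    [Module R W] :
    Function.Exact ((TensorProduct.assoc R M.carrier C W).toLinearMap ∘ₗ M.coact.rTensor W)
      (cotensorDiff M (LeftComod.tensor (LeftComod.regular R C) W)) := by
  have exact_sub := (M.linearSplitEqualizer_cotensor.rTensor W).exact_sub
  rw [← LinearMap.rTensor_sub] at exact_sub
  exact Function.Exact.of_ladder_linearEquiv_of_exact (e₁ := LinearEquiv.refl R _) rfl
    (LeftComod.cotensorDiff_tensor M (LeftComod.regular R C) W) exact_sub

end RightComod

theorem LeftComod.coactHom_universal {R : Type u} [CommRing R] {C : Type u} [AddCommGroup C]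
    [Module R C] [Coalgebra R C] (M : LeftComod R C) (W : Type u) [AddCommGroup W] [Module R W] :
    Function.Bijective fun g : M.carrier →ₗ[R] W =>
      coactHom M ≫ tensorMapRight (regular R C) g :=
  (ModuleCat.homEquiv.symm.trans
    ((forgetfulAdj R C).homEquiv M (ModuleCat.of R W))).bijective

namespace Bicomod

open LeftComod

section CotensorCofree

variable {R : Type u} [CommRing R] {C D : Type u} [AddCommGroup C] [Module R C] [Coalgebra R C]
  [AddCommGroup D] [Module R D] [Coalgebra R D] (X : Bicomod R C D)
  {V W : Type u} [AddCommGroup V] [Module R V] [AddCommGroup W] [Module R W]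

theorem coactRightTensor_naturality (g : V →ₗ[R] W) :
    tensorMapRight X.left g ≫ X.coactRightTensor W =
      X.coactRightTensor V ≫ tensorMapRight X.left (g.lTensor D) :=
  hom_ext (assoc_comp_rTensor_comp_lTensor X.right.coact g)

variable [Module.Flat R C]

/-- A comodule embedded in `X ⊗ N` as the kernel of `cotensorDiff` is isomorphic to `X □ N`. -/
noncomputable def isoCotensorLeft {M : LeftComod R C} {N : LeftComod R D}
    (f : M ⟶ tensor X.left N.carrier) (hf : Function.Injective f.lin)
    (exact_f : Function.Exact f.lin (cotensorDiff X.right N)) : M ≅ X.cotensorLeft N :=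
  isoOfRangeEq f (X.cotensorLeftι N) hf (X.cotensorLeftι_injective N)
    (exact_f.linearMap_ker_eq.symm.trans (Submodule.range_subtype _).symm)

theorem isoCotensorLeft_hom_comp {M : LeftComod R C} {N : LeftComod R D}
    (f : M ⟶ tensor X.left N.carrier) (hf : Function.Injective f.lin)
    (exact_f : Function.Exact f.lin (cotensorDiff X.right N)) :
    (X.isoCotensorLeft f hf exact_f).hom ≫ X.cotensorLeftι N = f :=
  isoOfRangeEq_hom_comp _ _ _ _ _

/-- The isomorphism of `X` with `X □ D`. -/
noncomputable def leftIso : X.left ≅ X.cotensorLeft (regular R D) :=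
  X.isoCotensorLeft X.coactRight X.right.linearSplitEqualizer_coact.injective
    X.right.exact_coact_cotensorDiff

theorem leftIso_comp : X.leftIso.hom ≫ X.cotensorLeftι (regular R D) = X.coactRight :=
  X.isoCotensorLeft_hom_comp _ _ _

variable (W) in
/-- The isomorphism of `X ⊗ W` with `X □ (D ⊗ W)`. -/
noncomputable def tensorIso : tensor X.left W ≅ X.cotensorLeft (tensor (regular R D) W) :=
  X.isoCotensorLeft (X.coactRightTensor W)
    ((TensorProduct.assoc R X.right.carrier D W).injective.comp
      (X.right.linearSplitEqualizer_coact.rTensor W).injective)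
    (X.right.exact_assoc_comp_rTensor_coact W)

variable (W) in
theorem tensorIso_comp :
    (X.tensorIso W).hom ≫ X.cotensorLeftι (tensor (regular R D) W) = X.coactRightTensor W :=
  X.isoCotensorLeft_hom_comp _ _ _

theorem hom_cotensorLeft_ext {M : LeftComod R C} {N : LeftComod R D} {f g : M ⟶ X.cotensorLeft N}
    (h : f ≫ X.cotensorLeftι N = g ≫ X.cotensorLeftι N) : f = g :=
  have := mono_of_injective (X.cotensorLeftι_injective N)
  (cancel_mono (X.cotensorLeftι N)).1 h

theorem tensorIso_naturality (g : V →ₗ[R] W) :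
    tensorMapRight X.left g ≫ (X.tensorIso W).hom = (X.tensorIso V).hom ≫
      X.cotensorLeftMap (tensorMapRight (regular R D) g) := by
  refine X.hom_cotensorLeft_ext ?_
  rw [Category.assoc, Category.assoc, cotensorLeftMap_comp_ι,
    ← Category.assoc _ (X.cotensorLeftι _), tensorIso_comp, tensorIso_comp]
  exact X.coactRightTensor_naturality g

/-- The functors `X ⊗ -` and `X □ (D ⊗ -)` agree. -/
noncomputable def tensorFunctorIso :
    X.left.tensorFunctor ≅ (regular R D).tensorFunctor ⋙ X.cotensorLeftFunctor :=
  NatIso.ofComponents (fun W => X.tensorIso W) fun g => X.tensorIso_naturality g.hom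

theorem coactRight_comp_tensorIso :
    X.coactRight ≫ (X.tensorIso D).hom =
      X.leftIso.hom ≫ X.cotensorLeftMap (coactHom (regular R D)) := by
  have coassoc : X.coactRight ≫ X.coactRightTensor D =
      X.coactRight ≫ tensorMapRight X.left Coalgebra.comul := hom_ext X.right.coassoc
  have leftIso_comp_comul : X.coactRight ≫ tensorMapRight X.left Coalgebra.comul =
      X.leftIso.hom ≫ X.cotensorLeftι _ ≫
        tensorMapRight X.left (Coalgebra.comul (R := R) (A := D)) :=
    (congrArg (· ≫ tensorMapRight X.left Coalgebra.comul) X.leftIso_comp.symm).trans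
      (Category.assoc _ _ _)
  refine X.hom_cotensorLeft_ext ?_
  rw [Category.assoc, tensorIso_comp]
  exact coassoc.trans (leftIso_comp_comul.trans (Category.assoc _ _ _).symm)

theorem coactRight_comp_tensorMapRight (g : D →ₗ[R] W) :
    X.coactRight ≫ tensorMapRight X.left g = X.leftIso.hom ≫
      X.cotensorLeftFunctor.map (coactHom (regular R D) ≫ tensorMapRight (regular R D) g) ≫
        (X.tensorIso W).symm.hom := by
  have comp_tensorIso : (X.coactRight ≫ tensorMapRight X.left g) ≫ (X.tensorIso W).hom =
      X.leftIso.hom ≫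
        X.cotensorLeftFunctor.map (coactHom (regular R D) ≫ tensorMapRight (regular R D) g) :=
    calc
      _ = X.coactRight ≫ (X.tensorIso D).hom ≫
          X.cotensorLeftMap (tensorMapRight (regular R D) g) :=
        (Category.assoc _ _ _).trans (congrArg (X.coactRight ≫ ·) (X.tensorIso_naturality g))
      _ = X.leftIso.hom ≫ X.cotensorLeftMap (coactHom (regular R D)) ≫
          X.cotensorLeftMap (tensorMapRight (regular R D) g) :=
        (Category.assoc _ _ _).symm.trans
          ((congrArg (· ≫ _) X.coactRight_comp_tensorIso).trans (Category.assoc _ _ _))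
      _ = _ := congrArg (X.leftIso.hom ≫ ·) (X.cotensorLeftFunctor.map_comp _ _).symm
  exact ((Iso.eq_comp_inv (X.tensorIso W)).2 comp_tensorIso).trans (Category.assoc _ _ _)

theorem coactRight_universal [X.cotensorLeftFunctor.IsEquivalence] (W : Type u) [AddCommGroup W]
    [Module R W] :
    Function.Bijective fun g : D →ₗ[R] W => X.coactRight ≫ tensorMapRight X.left g := by
  simp only [coactRight_comp_tensorMapRight]
  exact (bijective_comp_map_comp X.cotensorLeftFunctor X.leftIso (X.tensorIso W).symm).comp
    (coactHom_universal (regular R D) W)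

theorem nonempty_coend_left_coalgEquiv [X.cotensorLeftFunctor.IsEquivalence]
    [X.left.QuasiFinite] : Nonempty (X.left.Coend ≃ₗc[R] D) :=
  nonempty_coend_coalgEquiv_of_universal _ X.coactRight X.coactRight_universal
    (hom_ext X.right.coassoc.symm) (hom_ext X.right.counit_coact)

/-- The functor `X ⊗ -` is right adjoint to the inverse of `X □ -` followed by the forgetful
functor. -/
noncomputable def leftAdj [X.cotensorLeftFunctor.IsEquivalence] :
    X.cotensorLeftFunctor.inv ⋙ forgetful R D ⊣ X.left.tensorFunctor :=
  (X.cotensorLeftFunctor.asEquivalence.symm.toAdjunction.comp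
    (forgetfulAdj R D)).ofNatIsoRight X.tensorFunctorIso.symm

theorem left_quasiFinite [X.cotensorLeftFunctor.IsEquivalence] : X.left.QuasiFinite :=
  X.leftAdj.isRightAdjoint

theorem left_injector [Module.Flat R D] [X.cotensorLeftFunctor.IsEquivalence] :
    X.left.Injector :=
  fun W _ => Injective.injective_of_adjoint X.leftAdj W

theorem right_faithfullyCoflat [Module.Flat R D] [X.cotensorLeftFunctor.IsEquivalence] :
    X.right.FaithfullyCoflat :=
  ⟨fun _ _ _ _ _ h =>
      exact_map_of_isEquivalence (forgetful R D) (forgetful R C) X.cotensorLeftFunctor h,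
    inferInstanceAs (X.cotensorLeftFunctor ⋙ forgetful R C).Faithful⟩

end CotensorCofree

end Bicomod

namespace RightComod

section Equivalence

variable {R : Type u} [CommRing R]
  {C : Type u} [AddCommGroup C] [Module R C] [Coalgebra R C]
  {D : Type u} [AddCommGroup D] [Module R D] [Coalgebra R D]
  (E : RightComod R C ≌ RightComod R D) [E.functor.Additive] [E.functor.Linear R]

theorem exists_nonempty_imageBicomod_right_coend_coalgEquiv :
    ∃ _ : (imageBicomod E).right.QuasiFinite, Nonempty ((imageBicomod E).right.Coend ≃ₗc[R] C) :=
  have : (E.functor.obj (regular R C)).QuasiFinite := image_quasiFinite E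
  ⟨this, nonempty_coend_image_coalgEquiv E⟩

variable [Module.Flat R C] [Module.Flat R D]

instance isEquivalence_imageBicomod_cotensorLeftFunctor :
    (imageBicomod E).cotensorLeftFunctor.IsEquivalence :=
  have : Module.Flat R (imageBicomod E).right.carrier := image_flat E
  have : Module.Flat R (imageBicomod E.symm).right.carrier := image_flat E.symm
  have pure_symm : IsPureCotensor (imageBicomod E.symm) (imageBicomod E) _ :=
    isPureCotensor_imageBicomod E.symm
  inferInstanceAs ((isPureCotensor_imageBicomod E).equivalence pure_symm).functor.IsEquivalence

theorem imageBicomod_right_quasiFinite_faithfullyCoflat_injector :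
    (imageBicomod E).right.QuasiFinite ∧ (imageBicomod E).right.FaithfullyCoflat ∧
      (imageBicomod E).right.Injector :=
  ⟨image_quasiFinite E, (imageBicomod E).right_faithfullyCoflat, image_injector E⟩

theorem imageBicomod_left_quasiFinite_faithfullyCoflat_injector :
    (imageBicomod E).left.QuasiFinite ∧ (imageBicomod E).left.FaithfullyCoflat ∧
      (imageBicomod E).left.Injector :=
  ⟨(imageBicomod E).left_quasiFinite, image_left_faithfullyCoflat E,
    (imageBicomod E).left_injector⟩

theorem exists_nonempty_imageBicomod_left_coend_coalgEquiv :
    ∃ _ : (imageBicomod E).left.QuasiFinite, Nonempty ((imageBicomod E).left.Coend ≃ₗc[R] D) :=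
  have left_quasiFinite := (imageBicomod E).left_quasiFinite
  ⟨left_quasiFinite, (imageBicomod E).nonempty_coend_left_coalgEquiv⟩

end Equivalence

end RightComod

theorem mainTheorem8 {R : Type u} [CommRing R]
    {C : Type u} [AddCommGroup C] [Module R C] [Coalgebra R C] [Module.Flat R C]
    {D : Type u} [AddCommGroup D] [Module R D] [Coalgebra R D] [Module.Flat R D]
    (E : RightComod R C ≌ RightComod R D) [E.functor.Additive] [E.functor.Linear R] :
    -- `F(C)` as a right `D`-comodule
    ((imageBicomod E).right.QuasiFinite ∧
      (imageBicomod E).right.FaithfullyCoflat ∧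
      (imageBicomod E).right.Injector) ∧
    -- `F(C)` as a left `C`-comodule
    ((imageBicomod E).left.QuasiFinite ∧
      (imageBicomod E).left.FaithfullyCoflat ∧
      (imageBicomod E).left.Injector) ∧
    -- `e_D(F(C)) ≅ C` and `e_C(F(C)) ≅ D` as coalgebras
    (∃ _ : (imageBicomod E).right.QuasiFinite,
      Nonempty ((imageBicomod E).right.Coend ≃ₗc[R] C)) ∧
    (∃ _ : (imageBicomod E).left.QuasiFinite,
      Nonempty ((imageBicomod E).left.Coend ≃ₗc[R] D)) ∧
    -- `G(D)` as a right `C`-comodule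
    ((imageBicomod E.symm).right.QuasiFinite ∧
      (imageBicomod E.symm).right.FaithfullyCoflat ∧
      (imageBicomod E.symm).right.Injector) ∧
    -- `G(D)` as a left `D`-comodule
    ((imageBicomod E.symm).left.QuasiFinite ∧
      (imageBicomod E.symm).left.FaithfullyCoflat ∧
      (imageBicomod E.symm).left.Injector) ∧
    -- `e_C(G(D)) ≅ D` and `e_D(G(D)) ≅ C` as coalgebras
    (∃ _ : (imageBicomod E.symm).right.QuasiFinite,
      Nonempty ((imageBicomod E.symm).right.Coend ≃ₗc[R] D)) ∧
    (∃ _ : (imageBicomod E.symm).left.QuasiFinite,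
      Nonempty ((imageBicomod E.symm).left.Coend ≃ₗc[R] C)) :=
  ⟨RightComod.imageBicomod_right_quasiFinite_faithfullyCoflat_injector E,
    RightComod.imageBicomod_left_quasiFinite_faithfullyCoflat_injector E,
    RightComod.exists_nonempty_imageBicomod_right_coend_coalgEquiv E,
    RightComod.exists_nonempty_imageBicomod_left_coend_coalgEquiv E,
    RightComod.imageBicomod_right_quasiFinite_faithfullyCoflat_injector E.symm,
    RightComod.imageBicomod_left_quasiFinite_faithfullyCoflat_injector E.symm,
    RightComod.exists_nonempty_imageBicomod_right_coend_coalgEquiv E.symm,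
    RightComod.exists_nonempty_imageBicomod_left_coend_coalgEquiv E.symm⟩
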